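/- **Setting.** For continuous $f:\mathbf R^2\to\mathbf C$ with $\operatorname{supp} f\subset\{(x,y): y\ge x^2\}$ let $R[f](\xi,\eta)=\int_{\mathbf R} f(x,\xi x+\eta)\,dx$ be the Radon transform, and let $\|f\|_{C^{0,\alpha}}=\sup_{p\ne q}|f(p)-f(q)|/\|p-q\|^{\alpha}$ (Euclidean norm, $0<\alpha\le 1$). A *mollifier* is an even function $0\le\varphi\in C^\infty(\mathbf R)$ with $\operatorname{supp}\varphi\subset[-1,1]$ and $\int\varphi=1$; put $\varphi_r(t)=r^{-1}\varphi(t/r)$ for $r>0$. The vertical means of $f$ are $$\mathcal M_{\varphi,\varepsilon,\gamma}[f](x)=\int_{|y-\gamma|\le\varepsilon|x|} f(x,y)\,\varphi_{\varepsilon|x|}(\gamma-y)\,dy\quad(x\ne0),\qquad \mathcal M_{\varphi,\varepsilon,\gamma}[f](0)=f(0,\gamma).$$ A sequence $(\varphi_N)_{N\ge 0}$ of mollifiers is called *admissible with constant $C_1$* if $|\varphi_N^{(k)}|\le C_1^{k+1}N^k$ for all $0\le k\le N$. Let $\|\cdot\|_{\varepsilon,\gamma}$ ($0<\varepsilon<1$,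 $0<\gamma<1$) be any family of norms (values in $[0,\infty]$) on functions $g(\xi,\eta)$ such that, for a constant $c$ not depending on $\varepsilon,\gamma,g$ and all continuous $g$, $$\max\Big\{\iint_{|\xi|\le\varepsilon,\,|\eta|<\gamma}|g|\,d\xi\,d\eta,\ \int_{-\varepsilon}^{\varepsilon}|g(\xi,\gamma)|\,d\xi\Big\}\le c\,\|g\|_{\varepsilon,\gamma};$$ for instance $\|g\|_{\varepsilon,\gamma}=\sup_{|\eta|\le\gamma}\int_{-\varepsilon}^{\varepsilon}|g(\xi,\eta)|\,d\xi$, with $c=2$. (The norm axioms themselves are not needed.) **Theorem.** Admissible sequences of mollifiers exist. Moreover, for every $C_0\ge0$ there is $M>0$, depending only on $C_0$; for all $C_1,c$ there is $C\ge 1$, depending only on $C_0,C_1,c$; and for every $0<\varepsilon<1$ there is $0<\delta\le M$, depending only on $C_0,C_1,c,\varepsilon$, such that the following holds. Let $\varepsilon^2/4\le\gamma<1$, $0<\alpha\le1$, $\|f\|_{C^{0,\alpha}}\le C_0$, $\operatorname{supp} f\subset\{(x,y): y\ge x^2\}$, let $(\varphi_N)$ be admissible with constant $C_1$, let $\|\cdot\|_{\varepsilon,\gamma}$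 be as above with constant $c$, and suppose that $H:=\|R[f]\|_{\varepsilon,\gamma}<\delta$. 1. If $H>0$ and $N$ is the largest integer $\ge0$ not exceeding $\dfrac{\log(M/H)-\log(C/\varepsilon)}{\log(C/\varepsilon)}$ ($N=0$ if there is none), then $$\|\mathcal M_{\varphi_N,\varepsilon,\gamma}[f]\|_{L^2(\mathbf R)}\le 4M\left(\frac{\log(C/\varepsilon)}{\log(M/H)}\right)^{\alpha}.$$ 2. If $H=0$, then $\|\mathcal M_{\varphi_N,\varepsilon,\gamma}[f]\|_{L^2(\mathbf R)}=0$ for every $N$. -/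

import Mathlib

open MeasureTheory
open scoped NNReal ENNReal ContDiff

namespace LocalRadon

/-- The Radon transform `R[f](ξ, η) = ∫ f(x, ξ x + η) dx`. -/
noncomputable def radon (f : EuclideanSpace ℝ (Fin 2) → ℂ) (ξ η : ℝ) : ℂ :=
  ∫ x : ℝ, f !₂[x, ξ * x + η]

/-- The closed parabolic region `{(x, y) : y ≥ x²}`. -/
def parabola : Set (EuclideanSpace ℝ (Fin 2)) := {p | p 0 ^ 2 ≤ p 1}

/-- Admissible mollifiers: `0 ≤ φ ∈ C₀^∞[-1, 1]`, even, with `∫ φ = 1`. -/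
structure IsMollifier (φ : ℝ → ℝ) : Prop where
  smooth : ContDiff ℝ ∞ φ
  supp : tsupport φ ⊆ Set.Icc (-1) 1
  nonneg : ∀ t, 0 ≤ φ t
  even : ∀ t, φ (-t) = φ t
  integral_eq : ∫ t, φ t = 1

/-- The dilation `φ_r(t) = r⁻¹ φ(t / r)`. -/
noncomputable def dilate (φ : ℝ → ℝ) (r t : ℝ) : ℝ := r⁻¹ * φ (t / r)

open Classical in
/-- The vertical mean
`M_{φ,ε,γ}[f](x) = ∫_{|y - γ| ≤ ε|x|} f(x, y) φ_{ε|x|}(γ - y) dy` for `x ≠ 0`,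
and `M_{φ,ε,γ}[f](0) = f(0, γ)`. -/
noncomputable def vmean (φ : ℝ → ℝ) (ε γ : ℝ) (f : EuclideanSpace ℝ (Fin 2) → ℂ) (x : ℝ) : ℂ :=
  if x = 0 then f !₂[0, γ]
  else ∫ y in {y : ℝ | |y - γ| ≤ ε * |x|}, f !₂[x, y] * (dilate φ (ε * |x|) (γ - y) : ℂ)

/-- A sequence of mollifiers `φ_N` whose derivatives of order `k ≤ N` satisfy
`|φ_N^{(k)}| ≤ C₁^{k+1} N^k`, with `C₁` independent of `N` and `k`. -/
def IsMollifierSeq (C₁ : ℝ) (φ : ℕ → ℝ → ℝ) : Prop :=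
  ∀ N : ℕ, IsMollifier (φ N) ∧
    ∀ k ≤ N, ∀ t : ℝ, |iteratedDeriv k (φ N) t| ≤ C₁ ^ (k + 1) * (N : ℝ) ^ k

/-- The `L¹` norm of `g = g(ξ, η)` over `R_{ε,γ} = {(ξ, η) : |ξ| ≤ ε, |η| < γ}`. -/
noncomputable def rectNorm (ε γ : ℝ) (g : ℝ → ℝ → ℂ) : ℝ≥0∞ :=
  ∫⁻ p in {p : ℝ × ℝ | |p.1| ≤ ε ∧ |p.2| < γ}, ‖g p.1 p.2‖ₑ

/-- The `L¹[-ε, ε]` norm of the slice `g(·, γ)`. -/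
noncomputable def sliceNorm (ε γ : ℝ) (g : ℝ → ℝ → ℂ) : ℝ≥0∞ :=
  ∫⁻ ξ in Set.Icc (-ε) ε, ‖g ξ γ‖ₑ

/-- The property required of the data norms `‖·‖_{ε,γ}`:
`max {‖g‖_{L¹(R_{ε,γ})}, ‖g(·, γ)‖_{L¹[-ε, ε]}} ≤ c ‖g‖_{ε,γ}` with a constant `c` that does not
depend on `ε`, `γ`, `g`. The value `∞` is allowed. Neither the norm axioms nor monotonicity in
`ε`, `γ` are imposed, so every norm with this property is covered, for instance
`sup_{|η| ≤ γ} ‖g(·, η)‖_{L¹[-ε, ε]}` with `c = 2`. -/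
def IsDataNorm (c : ℝ≥0) (nrm : ℝ → ℝ → (ℝ → ℝ → ℂ) → ℝ≥0∞) : Prop :=
  ∀ ε γ : ℝ, 0 < ε → ε < 1 → 0 < γ → γ < 1 →
    ∀ g : ℝ → ℝ → ℂ, Continuous (fun p : ℝ × ℝ => g p.1 p.2) →
      max (rectNorm ε γ g) (sliceNorm ε γ g) ≤ (c : ℝ≥0∞) * nrm ε γ g

/-- The index `N` of the mollifier used for data of size `H`: the largest natural number
with `N ≤ (log (M / H) - log (C / ε)) / log (C / ε)`. -/
noncomputable def mollifierIndex (M C ε H : ℝ) : ℕ :=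
  ⌊(Real.log (M / H) - Real.log (C / ε)) / Real.log (C / ε)⌋₊

end LocalRadon

/-! The substitution $y=\gamma+\xi x$ turns the vertical mean into $g(x)=\int\psi(\xi)f(x,\gamma+\xi
x)\,d\xi$, $\psi=\varphi_\varepsilon$, an average over lines through $(0,\gamma)$
(`vmean_eq_slopeMean`). Let $F_k$ be the $k$-th primitive of $f$ in $y$. Since $\partial_\xi
F_{k+1}(x,\gamma+\xi x)=xF_k(x,\gamma+\xi x)$, $k$ integrations by parts and Fubini express $\int
x^kg$ through $\psi^{(k)}$ and $R[F_k](\cdot,\gamma)$ (`integral_pow_mul_slopeMean`). For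
$\xi^2\le4\gamma$ the line $y=\xi x-\gamma$ lies below the parabola, so $R[F_k](\xi,\cdot)$ is the
$k$-fold primitive of $R[f](\xi,\cdot)$ from $-\gamma$, and repeated integration gains a factorial
(`norm_primRadon_le`). With $|\varphi_N^{(k)}|\le C_1^{k+1}N^k$ all moments of order $k\le N$ are at
most $H$ times a factor geometric in $N$ (`norm_moment_le`, `norm_moment_le_exp`).

As $g$ is supported in $[-2,2]\subset[-\pi,\pi]$, Parseval applies. Taylor expansion of $e^{-inx}$
controls the coefficients with $|n|\lesssim N$ by the moments (`norm_circleCoeff_le`); Hölder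
continuity makes the remaining ones contribute $O(N^{-2\alpha})$ (`sum_high_circleCoeff_le`). The
index $N\approx\log(M/H)/\log(C/\varepsilon)$ is the largest for which the geometric factor is still
absorbed by $H$. If $H=0$, all moments vanish, hence all Fourier coefficients. -/

namespace LocalRadon

/-! ### Construction of admissible mollifiers. -/

/-- The average of `u` over the interval `[t - r, t + r]`. -/
noncomputable def boxAverage (r : ℝ) (u : ℝ → ℝ) (t : ℝ) : ℝ :=
  (2 * r)⁻¹ * ∫ s in (-r)..r, u (t + s)

theorem hasDerivAt_boxAverage {r : ℝ} {u : ℝ → ℝ} (hu : Continuous u) (t : ℝ) :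
    HasDerivAt (boxAverage r u) ((2 * r)⁻¹ * (u (t + r) - u (t - r))) t := by
  have h1 : boxAverage r u =
      fun t => (2 * r)⁻¹ * ((∫ s in (0:ℝ)..(t + r), u s) - ∫ s in (0:ℝ)..(t - r), u s) := by
    funext t
    rw [boxAverage, intervalIntegral.integral_comp_add_left (fun s => u s) t,
      intervalIntegral.integral_interval_sub_left (hu.intervalIntegrable _ _)
        (hu.intervalIntegrable _ _), ← sub_eq_add_neg]
  rw [h1]
  refine HasDerivAt.const_mul _ (HasDerivAt.sub ?_ ?_)
  · have := (hu.integral_hasStrictDerivAt 0 (t + r)).hasDerivAt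
    exact this.comp_add_const t r
  · have := (hu.integral_hasStrictDerivAt 0 (t - r)).hasDerivAt
    exact this.comp_sub_const t r

theorem deriv_boxAverage {r : ℝ} {u : ℝ → ℝ} (hu : Continuous u) :
    deriv (boxAverage r u) = fun t => (2 * r)⁻¹ * (u (t + r) - u (t - r)) :=
  funext fun t => (hasDerivAt_boxAverage hu t).deriv

theorem contDiff_boxAverage {r : ℝ} {u : ℝ → ℝ} (hu : ContDiff ℝ ∞ u) :
    ContDiff ℝ ∞ (boxAverage r u) := by
  rw [contDiff_infty_iff_deriv]
  refine ⟨fun t => (hasDerivAt_boxAverage hu.continuous t).differentiableAt, ?_⟩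
  rw [deriv_boxAverage hu.continuous]
  fun_prop

theorem integral_boxAverage {r : ℝ} (hr : 0 < r) {u : ℝ → ℝ} (hu : Continuous u)
    (hc : HasCompactSupport u) : ∫ t, boxAverage r u t = ∫ t, u t := by
  have : IsFiniteMeasure (volume.restrict (Set.uIoc (-r) r)) := by
    rw [Set.uIoc_of_le (by linarith)]
    infer_instance
  have hi : Integrable (Function.uncurry fun s t : ℝ => u (t + s))
      ((volume.restrict (Set.uIoc (-r) r)).prod volume) := by
    have h0 : Integrable (Function.uncurry fun (_ : ℝ) (t : ℝ) => u t)
        ((volume.restrict (Set.uIoc (-r) r)).prod volume) := by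
      have h1 : Integrable (fun _ : ℝ => (1 : ℝ)) (volume.restrict (Set.uIoc (-r) r)) :=
        integrable_const _
      simpa [Function.uncurry_def] using h1.mul_prod (hu.integrable_of_hasCompactSupport hc)
    have hmp : MeasurePreserving (fun p : ℝ × ℝ => (p.1, p.2 + p.1))
        ((volume.restrict (Set.uIoc (-r) r)).prod volume)
        ((volume.restrict (Set.uIoc (-r) r)).prod volume) :=
      measurePreserving_prod_add_right _ _
    exact hmp.integrable_comp_of_integrable h0
  have hsw := intervalIntegral_integral_swap hi
  simp only [boxAverage, integral_const_mul]
  rw [← hsw]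
  simp only [integral_add_right_eq_self (fun t => u t), intervalIntegral.integral_const]
  rw [smul_eq_mul]
  field_simp
  ring

/-- After `j` box averages at scale `r` a bump keeps its mass, its support grows by `j * r`, and its
derivatives of order at most `j` grow like powers of `r⁻¹`. -/
theorem exists_iterated_boxAverage {ψ : ℝ → ℝ} {B r : ℝ} (hr : 0 < r) (hψ : ContDiff ℝ ∞ ψ)
    (hs : ∀ t, 1 / 2 < |t| → ψ t = 0) (h0 : ∀ t, 0 ≤ ψ t) (he : ∀ t, ψ (-t) = ψ t)
    (hint : ∫ t, ψ t = 1) (hB : ∀ t, ψ t ≤ B) (j : ℕ) :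
    ∃ u : ℝ → ℝ, ContDiff ℝ ∞ u ∧ (∀ t, 1 / 2 + j * r < |t| → u t = 0) ∧ (∀ t, 0 ≤ u t) ∧
      (∀ t, u (-t) = u t) ∧ ∫ t, u t = 1 ∧
      ∀ k ≤ j, ∀ t, |iteratedDeriv k u t| ≤ B * (r⁻¹) ^ k := by
  induction j with
  | zero =>
    refine ⟨ψ, hψ, by simpa using hs, h0, he, hint, fun k hk t => ?_⟩
    obtain rfl : k = 0 := by omega
    simpa [abs_of_nonneg (h0 t)] using hB t
  | succ j ih =>
    obtain ⟨u, hu, hus, hu0, hue, hui, hud⟩ := ih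
    have hcs : HasCompactSupport u := by
      refine HasCompactSupport.intro (isCompact_Icc (a := -(1 / 2 + j * r)) (b := 1 / 2 + j * r)) ?_
      intro t ht
      apply hus
      by_contra h
      exact ht (abs_le.1 (not_lt.1 h))
    refine ⟨boxAverage r u, contDiff_boxAverage hu, ?_, ?_, ?_, ?_, ?_⟩
    · intro t ht
      have : ∫ s in (-r)..r, u (t + s) = ∫ s in (-r)..r, (0 : ℝ) := by
        refine intervalIntegral.integral_congr fun s hs => ?_
        rw [Set.uIcc_of_le (by linarith)] at hs
        refine hus _ ?_
        have h1 : |t| ≤ |t + s| + |s| := by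
          simpa using abs_sub (t + s) s
        have h2 : |s| ≤ r := abs_le.2 hs
        push_cast at ht
        nlinarith
      simp [boxAverage, this]
    · intro t
      exact mul_nonneg (by positivity)
        (intervalIntegral.integral_nonneg (by linarith) fun s _ => hu0 _)
    · intro t
      have := intervalIntegral.integral_comp_neg (a := -r) (b := r) (fun s => u (t + s))
      rw [neg_neg] at this
      simp only [boxAverage]
      rw [← this]
      congr 1
      refine intervalIntegral.integral_congr fun s _ => ?_
      rw [← hue]
      ring_nf
    · rw [integral_boxAverage hr hu.continuous hcs, hui]
    · intro k hk t
      cases k with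
      | zero =>
        have hb : ∀ t, |u t| ≤ B := fun t => by simpa using hud 0 (Nat.zero_le _) t
        have := intervalIntegral.norm_integral_le_of_norm_le_const (a := -r) (b := r)
          (f := fun s => u (t + s)) (C := B) (fun s _ => hb _)
        rw [Real.norm_eq_abs, sub_neg_eq_add, abs_of_pos (by linarith : 0 < r + r)] at this
        simp only [iteratedDeriv_zero, boxAverage, pow_zero, mul_one]
        rw [abs_mul, abs_of_pos (by positivity : 0 < (2 * r)⁻¹)]
        calc (2 * r)⁻¹ * |∫ s in (-r)..r, u (t + s)| ≤ (2 * r)⁻¹ * (B * (r + r)) := by gcongr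
          _ = B := by field_simp; ring
      | succ k =>
        have hk' : k ≤ j := by omega
        have hk2 : ∀ c : ℝ, ContDiff ℝ k fun t => u (t + c) := fun c =>
          (hu.of_le (by exact_mod_cast le_top)).comp (by fun_prop)
        -- The derivative of a box average is a difference quotient of `u`: the new order costs one
        -- factor `r⁻¹` and uses `u` only to order `k ≤ j`.
        rw [iteratedDeriv_succ', deriv_boxAverage hu.continuous]
        have : iteratedDeriv k (fun t => (2 * r)⁻¹ * (u (t + r) - u (t - r))) t =
            (2 * r)⁻¹ * (iteratedDeriv k u (t + r) - iteratedDeriv k u (t - r)) := by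
          simp only [sub_eq_add_neg _ r]
          rw [iteratedDeriv_const_mul_field,
            iteratedDeriv_fun_sub (hk2 _).contDiffAt (hk2 _).contDiffAt,
            iteratedDeriv_comp_add_const, iteratedDeriv_comp_add_const]
        rw [this, abs_mul, abs_of_pos (by positivity : 0 < (2 * r)⁻¹)]
        calc (2 * r)⁻¹ * |iteratedDeriv k u (t + r) - iteratedDeriv k u (t - r)|
            ≤ (2 * r)⁻¹ * (B * (r⁻¹) ^ k + B * (r⁻¹) ^ k) := by
              gcongr
              exact (abs_sub _ _).trans (add_le_add (hud k hk' _) (hud k hk' _))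
          _ = B * (r⁻¹) ^ (k + 1) := by rw [pow_succ]; field_simp; ring

/-- Average a bump supported in $[-1/2,1/2]$ $N$ times at scale $1/(2N)$: the support grows by $1/2$
in total and each derivative up to order $N$ costs $2N$. -/
theorem exists_isMollifierSeq : ∃ (C₁ : ℝ) (φ : ℕ → ℝ → ℝ), IsMollifierSeq C₁ φ := by
  let β : ContDiffBump (0 : ℝ) := ⟨1 / 4, 1 / 2, by norm_num, by norm_num⟩
  set ψ : ℝ → ℝ := β.normed volume with hψ
  have hc : ContDiff ℝ ∞ ψ := β.contDiff_normed
  obtain ⟨B, hB⟩ := β.hasCompactSupport_normed (μ := volume).exists_bound_of_continuous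
    β.continuous_normed
  have hs : ∀ t, 1 / 2 < |t| → ψ t = 0 := by
    intro t ht
    rw [← Function.notMem_support, hψ, β.support_normed_eq]
    simpa [β] using ht.le
  have hB' : ∀ t, ψ t ≤ B := fun t => (le_abs_self _).trans (hB t)
  have hB0 : 0 ≤ B := (β.nonneg_normed 0).trans (hB' 0)
  have key : ∀ N : ℕ, ∃ u : ℝ → ℝ, IsMollifier u ∧
      ∀ k ≤ N, ∀ t, |iteratedDeriv k u t| ≤ (max 2 B) ^ (k + 1) * (N : ℝ) ^ k := by
    intro N
    -- The maximum keeps the scale positive for `N = 0`, where no averaging takes place.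
    have hr : 0 < 1 / (2 * ((max N 1 : ℕ) : ℝ)) := by positivity
    obtain ⟨u, h1, h2, h3, h4, h5, h6⟩ := exists_iterated_boxAverage hr hc hs
      (fun t => β.nonneg_normed t) (fun t => β.normed_neg t) (β.integral_normed) hB' N
    refine ⟨u, ⟨h1, ?_, h3, h4, h5⟩, fun k hk t => (h6 k hk t).trans ?_⟩
    · refine closure_minimal (fun t ht => abs_le.1 (not_lt.1 fun h => ht (h2 t ?_))) isClosed_Icc
      refine lt_of_le_of_lt ?_ h
      have : (N : ℝ) ≤ (max N 1 : ℕ) := by exact_mod_cast le_max_left _ _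
      have h' : (N : ℝ) * (1 / (2 * ((max N 1 : ℕ) : ℝ))) ≤ 1 / 2 := by
        rw [mul_one_div, div_le_div_iff₀ (by positivity) (by norm_num)]
        linarith
      linarith
    · rcases Nat.eq_zero_or_pos N with rfl | hN
      · obtain rfl : k = 0 := by omega
        simp
      · rw [Nat.max_eq_left hN, one_div, inv_inv, mul_pow, pow_succ' (max 2 B), ← mul_assoc]
        gcongr
        · exact le_max_right _ _
        · exact le_max_left _ _
  choose φ hφ hφ' using key
  exact ⟨max 2 B, φ, fun N => ⟨hφ N, hφ' N⟩⟩

/-! ### Iterated primitives and the moments of slope means. -/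

/-- The iterated primitive, based at `0`, of `F` in its second variable. -/
noncomputable def iterPrim (F : ℝ → ℝ → ℂ) : ℕ → ℝ → ℝ → ℂ
  | 0 => F
  | k + 1 => fun x t => ∫ s in (0 : ℝ)..t, iterPrim F k x s

/-- The Radon transform of the iterated primitive, over `|x| ≤ 2`. -/
noncomputable def primRadon (F : ℝ → ℝ → ℂ) (k : ℕ) (ξ η : ℝ) : ℂ :=
  ∫ x in (-2 : ℝ)..2, iterPrim F k x (ξ * x + η)

/-- The average of `F` over the lines through `(0, γ)` with slope in `[-ε, ε]`, with weight `ψ`. -/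
noncomputable def slopeMean (ψ : ℝ → ℝ) (ε γ : ℝ) (F : ℝ → ℝ → ℂ) (x : ℝ) : ℂ :=
  ∫ ξ in (-ε)..ε, (ψ ξ : ℂ) * F x (γ + ξ * x)

section

variable {F : ℝ → ℝ → ℂ}

theorem continuous_iterPrim (hF : Continuous (Function.uncurry F)) (k : ℕ) :
    Continuous (Function.uncurry (iterPrim F k)) := by
  induction k with
  | zero => exact hF
  | succ k ih =>
    have h : Continuous (Function.uncurry fun (p : ℝ × ℝ) (s : ℝ) => iterPrim F k p.1 s) :=
      ih.comp (by fun_prop : Continuous fun q : (ℝ × ℝ) × ℝ => (q.1.1, q.2))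
    exact intervalIntegral.continuous_parametric_intervalIntegral_of_continuous
      (μ := volume) (a₀ := 0) h (s := fun p : ℝ × ℝ => p.2) continuous_snd

theorem continuous_iterPrim_comp (hF : Continuous (Function.uncurry F)) (k : ℕ) {X : Type*}
    [TopologicalSpace X] {a b : X → ℝ} (ha : Continuous a) (hb : Continuous b) :
    Continuous fun p => iterPrim F k (a p) (b p) :=
  (continuous_iterPrim hF k).comp (ha.prodMk hb)

/-- The base point $0$ lies below the parabola for every $x$, so a primitive from $0$ is also one
from $-\infty$. -/
theorem iterPrim_eq_zero (h0 : ∀ x t, t ≤ x ^ 2 → F x t = 0) (k : ℕ) :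
    ∀ x t, t ≤ x ^ 2 → iterPrim F k x t = 0 := by
  induction k with
  | zero => exact h0
  | succ k ih =>
    intro x t ht
    have : ∫ s in (0 : ℝ)..t, iterPrim F k x s = ∫ s in (0 : ℝ)..t, (0 : ℂ) := by
      refine intervalIntegral.integral_congr fun s hs => ih x s ?_
      rw [Set.mem_uIcc] at hs
      rcases hs with hs | hs
      · exact hs.2.trans ht
      · exact hs.2.trans (sq_nonneg x)
    simpa [iterPrim] using this

theorem continuous_primRadon (hF : Continuous (Function.uncurry F)) (k : ℕ) :
    Continuous (Function.uncurry (primRadon F k)) := by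
  refine intervalIntegral.continuous_parametric_intervalIntegral_of_continuous'
    (f := fun (p : ℝ × ℝ) (x : ℝ) => iterPrim F k x (p.1 * x + p.2)) ?_ _ _
  exact continuous_iterPrim_comp hF k (by fun_prop) (by fun_prop)

theorem continuous_primRadon_comp (hF : Continuous (Function.uncurry F)) (k : ℕ) {X : Type*}
    [TopologicalSpace X] {a b : X → ℝ} (ha : Continuous a) (hb : Continuous b) :
    Continuous fun p => primRadon F k (a p) (b p) :=
  (continuous_primRadon hF k).comp (ha.prodMk hb)

theorem hasDerivAt_iterPrim (hF : Continuous (Function.uncurry F)) (k : ℕ) (x t : ℝ) :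
    HasDerivAt (iterPrim F (k + 1) x) (iterPrim F k x t) t :=
  ((continuous_iterPrim_comp hF k continuous_const continuous_id).integral_hasStrictDerivAt
    0 t).hasDerivAt

theorem intervalIntegral_swap_of_continuous {f : ℝ → ℝ → ℂ} (hf : Continuous (Function.uncurry f))
    (a b c d : ℝ) :
    ∫ x in a..b, ∫ y in c..d, f x y = ∫ y in c..d, ∫ x in a..b, f x y := by
  refine intervalIntegral_intervalIntegral_swap ?_
  change IntegrableOn (Function.uncurry f) (Set.uIoc a b ×ˢ Set.uIoc c d) volume
  refine (hf.continuousOn.integrableOn_compact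
    (isCompact_uIcc (a := a) (b := b) |>.prod (isCompact_uIcc (a := c) (b := d)))).mono_set ?_
  exact Set.prod_mono Set.uIoc_subset_uIcc Set.uIoc_subset_uIcc

/-- Primitives of $F$ vanish on the line $y=\xi x-\gamma$, so there is no constant of integration at
$\eta=-\gamma$. -/
theorem primRadon_succ (hF : Continuous (Function.uncurry F))
    (h0 : ∀ x t, t ≤ x ^ 2 → F x t = 0) {γ ξ : ℝ} (hξ : ξ ^ 2 ≤ 4 * γ) (k : ℕ) (η : ℝ) :
    primRadon F (k + 1) ξ η = ∫ s in (-γ)..η, primRadon F k ξ s := by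
  simp only [primRadon]
  rw [intervalIntegral_swap_of_continuous (f := fun s x => iterPrim F k x (ξ * x + s))
    (continuous_iterPrim_comp hF k (by fun_prop) (by fun_prop))]
  refine intervalIntegral.integral_congr fun x _ => ?_
  simp only [intervalIntegral.integral_comp_add_left (fun s => iterPrim F k x s)]
  have hi : ∀ a b, IntervalIntegrable (iterPrim F k x) volume a b := fun a b =>
    (continuous_iterPrim_comp hF k continuous_const continuous_id).intervalIntegrable a b
  rw [← intervalIntegral.integral_interval_sub_left (hi 0 _) (hi 0 _)]
  -- Here $x^2-\xi x+\gamma\ge(x-\xi/2)^2$ because $\xi^2\le4\gamma$; this is where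
  -- $\gamma\ge\varepsilon^2/4$ enters.
  have := iterPrim_eq_zero h0 (k + 1) x (ξ * x + -γ) (by nlinarith [sq_nonneg (x - ξ / 2)])
  simp only [iterPrim] at this ⊢
  rw [this, sub_zero]

/-- Cauchy's estimate for repeated integration; the factorial later compensates $N^k$ from the
mollifier derivatives. -/
theorem norm_primRadon_le (hF : Continuous (Function.uncurry F))
    (h0 : ∀ x t, t ≤ x ^ 2 → F x t = 0) {γ ξ : ℝ} (hξ : ξ ^ 2 ≤ 4 * γ) (k : ℕ) :
    ∀ η, -γ ≤ η → η ≤ γ → ‖primRadon F (k + 1) ξ η‖ ≤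
      (∫ s in (-γ)..γ, ‖primRadon F 0 ξ s‖) * ((η + γ) ^ k / k.factorial) := by
  have hγ : -γ ≤ γ := by nlinarith [sq_nonneg ξ]
  have hc : ∀ k, Continuous fun s => primRadon F k ξ s := fun k =>
    continuous_primRadon_comp hF k continuous_const continuous_id
  induction k with
  | zero =>
    intro η h1 h2
    rw [primRadon_succ hF h0 hξ]
    simp only [pow_zero, Nat.factorial_zero, Nat.cast_one, div_one, mul_one]
    refine (intervalIntegral.norm_integral_le_integral_norm h1).trans ?_
    exact intervalIntegral.integral_mono_interval le_rfl h1 h2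
      (Filter.Eventually.of_forall fun _ => norm_nonneg _)
      ((hc 0).norm.intervalIntegrable _ _)
  | succ k ih =>
    intro η h1 h2
    rw [primRadon_succ hF h0 hξ]
    set A := ∫ s in (-γ)..γ, ‖primRadon F 0 ξ s‖
    have h3 : ∫ s in (-γ)..η, ‖primRadon F (k + 1) ξ s‖ ≤
        ∫ s in (-γ)..η, A * ((s + γ) ^ k / k.factorial) := by
      refine intervalIntegral.integral_mono_on h1 ((hc _).norm.intervalIntegrable _ _)
        ((by fun_prop : Continuous _).intervalIntegrable _ _) fun s hs => ?_
      exact ih s hs.1 (hs.2.trans h2)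
    refine (intervalIntegral.norm_integral_le_integral_norm h1).trans (h3.trans (le_of_eq ?_))
    rw [intervalIntegral.integral_const_mul, intervalIntegral.integral_div,
      intervalIntegral.integral_comp_add_right (fun s => s ^ k), integral_pow]
    rw [Nat.factorial_succ]
    have : (k.factorial : ℝ) ≠ 0 := by positivity
    push_cast
    have h2 : (k + 1 : ℝ) ≠ 0 := by positivity
    field_simp
    simp

/-- The endpoints are reached by continuity from outside the support; they are what kills the
boundary terms in the integrations by parts. -/
theorem iteratedDeriv_eq_zero_of_abs_ge {ψ : ℝ → ℝ} {ε : ℝ} (hψ : ContDiff ℝ ∞ ψ)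
    (hs : tsupport ψ ⊆ Set.Icc (-ε) ε) (k : ℕ) {t : ℝ} (ht : ε ≤ |t|) : iteratedDeriv k ψ t = 0 := by
  have hc : Continuous (iteratedDeriv k ψ) := hψ.continuous_iteratedDeriv k (by exact_mod_cast le_top)
  have hout : ∀ s, ε < |s| → iteratedDeriv k ψ s = 0 := by
    intro s hs'
    have h1 : s ∉ tsupport ψ := fun h => by
      have := abs_le.2 (hs h)
      linarith
    have h2 : ψ =ᶠ[nhds s] fun _ => 0 := notMem_tsupport_iff_eventuallyEq.1 h1
    rw [h2.iteratedDeriv_eq k]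
    cases k <;> simp
  have hclosed : IsClosed {s | iteratedDeriv k ψ s = 0} := isClosed_eq hc continuous_const
  rcases ht.lt_or_eq with h | h
  · exact hout t h
  · have key : ∀ ι : ℝ → ℝ, Continuous ι → ι 0 = t → (∀ r > 0, ε < |ι r|) →
        iteratedDeriv k ψ t = 0 := by
      intro ι hι hι0 hr
      have : Filter.Tendsto (fun r => iteratedDeriv k ψ (ι r)) (nhdsWithin 0 (Set.Ioi 0))
          (nhds (iteratedDeriv k ψ (ι 0))) := ((hc.comp hι).tendsto 0).mono_left nhdsWithin_le_nhds
      have h' : Filter.Tendsto (fun r => iteratedDeriv k ψ (ι r)) (nhdsWithin 0 (Set.Ioi 0))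
          (nhds 0) := by
        refine tendsto_const_nhds.congr' ?_
        filter_upwards [self_mem_nhdsWithin] with r hr'
        exact (hout _ (hr r hr')).symm
      rw [← hι0]
      exact tendsto_nhds_unique this h'
    rcases le_total 0 t with h0 | h0
    · refine key (fun r => t + r) (by fun_prop) (by simp) fun r hr => ?_
      rw [abs_of_nonneg (by linarith)]
      rw [abs_of_nonneg h0] at h
      linarith
    · refine key (fun r => t - r) (by fun_prop) (by simp) fun r hr => ?_
      rw [abs_of_nonpos (by linarith)]
      rw [abs_of_nonpos h0] at h
      linarith

/-- Each factor $x$ is the inner derivative of $\xi\mapsto\gamma+\xi x$, so an integration by parts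
trades it for one derivative of $\psi$ and one primitive of $F$. -/
theorem pow_mul_slopeMean (hF : Continuous (Function.uncurry F)) {ψ : ℝ → ℝ} {ε : ℝ}
    (hψ : ContDiff ℝ ∞ ψ) (hs : tsupport ψ ⊆ Set.Icc (-ε) ε) (γ x : ℝ) (k : ℕ) :
    (x : ℂ) ^ k * slopeMean ψ ε γ F x =
      (-1) ^ k * ∫ ξ in (-ε)..ε, ((iteratedDeriv k ψ ξ : ℝ) : ℂ) * iterPrim F k x (γ + ξ * x) := by
  induction k with
  | zero => simp [slopeMean, iterPrim]
  | succ k ih =>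
    have hcd : ∀ j, Continuous (iteratedDeriv j ψ) := fun j =>
      hψ.continuous_iteratedDeriv j (by exact_mod_cast le_top)
    have hcp : ∀ j, Continuous fun ξ : ℝ => iterPrim F j x (γ + ξ * x) := fun j =>
      continuous_iterPrim_comp hF j (by fun_prop) (by fun_prop)
    have hu : ∀ ξ : ℝ, HasDerivAt (fun ξ => ((iteratedDeriv k ψ ξ : ℝ) : ℂ))
        ((iteratedDeriv (k + 1) ψ ξ : ℝ) : ℂ) ξ := fun ξ => by
      have : HasDerivAt (iteratedDeriv k ψ) (iteratedDeriv (k + 1) ψ ξ) ξ := by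
        rw [iteratedDeriv_succ]
        exact (hψ.differentiable_iteratedDeriv k (by exact_mod_cast WithTop.coe_lt_top _)
          ξ).hasDerivAt
      exact this.ofReal_comp
    have hv : ∀ ξ : ℝ, HasDerivAt (fun ξ : ℝ => iterPrim F (k + 1) x (γ + ξ * x))
        (x * iterPrim F k x (γ + ξ * x)) ξ := fun ξ => by
      have h1 : HasDerivAt (fun ξ : ℝ => γ + ξ * x) x ξ := by
        simpa using ((hasDerivAt_id ξ).mul_const x).const_add γ
      have := (hasDerivAt_iterPrim hF k x (γ + ξ * x)).scomp ξ h1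
      rw [Complex.real_smul] at this
      exact this
    have hibp := intervalIntegral.integral_mul_deriv_eq_deriv_mul (a := -ε) (b := ε)
      (fun ξ _ => hu ξ) (fun ξ _ => hv ξ)
      ((Complex.continuous_ofReal.comp (hcd (k + 1))).intervalIntegrable _ _)
      ((continuous_const.mul (hcp k)).intervalIntegrable _ _)
    rw [iteratedDeriv_eq_zero_of_abs_ge hψ hs k (le_abs_self ε),
      iteratedDeriv_eq_zero_of_abs_ge hψ hs k ((le_abs_self ε).trans (abs_neg ε).symm.le)] at hibp
    rw [pow_succ', mul_assoc, ih, pow_succ, mul_assoc ((-1 : ℂ) ^ k), neg_one_mul]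
    rw [mul_left_comm]
    congr 1
    rw [← intervalIntegral.integral_const_mul]
    have e : ∀ ξ : ℝ, (x : ℂ) * (((iteratedDeriv k ψ ξ : ℝ) : ℂ) * iterPrim F k x (γ + ξ * x)) =
        ((iteratedDeriv k ψ ξ : ℝ) : ℂ) * (x * iterPrim F k x (γ + ξ * x)) := fun ξ => by ring
    simp only [e]
    rw [hibp]
    simp

theorem integral_pow_mul_slopeMean (hF : Continuous (Function.uncurry F)) {ψ : ℝ → ℝ} {ε : ℝ}
    (hψ : ContDiff ℝ ∞ ψ) (hs : tsupport ψ ⊆ Set.Icc (-ε) ε) (γ : ℝ) (k : ℕ) :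
    ∫ x in (-2 : ℝ)..2, (x : ℂ) ^ k * slopeMean ψ ε γ F x =
      (-1) ^ k * ∫ ξ in (-ε)..ε, ((iteratedDeriv k ψ ξ : ℝ) : ℂ) * primRadon F k ξ γ := by
  have hcd : Continuous (iteratedDeriv k ψ) :=
    hψ.continuous_iteratedDeriv k (by exact_mod_cast le_top)
  simp only [pow_mul_slopeMean hF hψ hs]
  rw [intervalIntegral.integral_const_mul, intervalIntegral_swap_of_continuous
    (f := fun x ξ => ((iteratedDeriv k ψ ξ : ℝ) : ℂ) * iterPrim F k x (γ + ξ * x))]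
  · simp only [intervalIntegral.integral_const_mul, primRadon, add_comm γ]
  · exact (Complex.continuous_ofReal.comp (hcd.comp continuous_snd)).mul
      (continuous_iterPrim_comp hF k (by fun_prop) (by fun_prop))

/-- The zeroth moment involves no primitive, hence needs the data on the slice $\eta=\gamma$ itself;
all higher moments need only the data on the rectangle. -/
theorem norm_integral_slopeMean_le (hF : Continuous (Function.uncurry F)) {ψ : ℝ → ℝ} {ε γ D : ℝ}
    (hε : 0 ≤ ε) (hψ : ContDiff ℝ ∞ ψ) (hs : tsupport ψ ⊆ Set.Icc (-ε) ε)
    (hD : ∀ t, |ψ t| ≤ D) :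
    ‖∫ x in (-2 : ℝ)..2, slopeMean ψ ε γ F x‖ ≤ D * ∫ ξ in (-ε)..ε, ‖primRadon F 0 ξ γ‖ := by
  have h := integral_pow_mul_slopeMean hF hψ hs γ 0
  simp only [pow_zero, one_mul, iteratedDeriv_zero] at h
  have hc : Continuous fun ξ => primRadon F 0 ξ γ :=
    continuous_primRadon_comp hF 0 continuous_id continuous_const
  have hψc := hψ.continuous
  rw [h, ← intervalIntegral.integral_const_mul]
  refine (intervalIntegral.norm_integral_le_integral_norm (by linarith)).trans ?_
  refine intervalIntegral.integral_mono_on (by linarith)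
    ((by fun_prop : Continuous _).intervalIntegrable _ _)
    ((by fun_prop : Continuous _).intervalIntegrable _ _) fun ξ _ => ?_
  rw [norm_mul, Complex.norm_real, Real.norm_eq_abs]
  gcongr
  exact hD ξ

theorem norm_moment_slopeMean_le (hF : Continuous (Function.uncurry F))
    (h0 : ∀ x t, t ≤ x ^ 2 → F x t = 0) {ψ : ℝ → ℝ} {ε γ D : ℝ} (hε : 0 ≤ ε)
    (hγ : ε ^ 2 ≤ 4 * γ) (hψ : ContDiff ℝ ∞ ψ) (hs : tsupport ψ ⊆ Set.Icc (-ε) ε) (k : ℕ)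
    (hD : ∀ t, |iteratedDeriv (k + 1) ψ t| ≤ D) :
    ‖∫ x in (-2 : ℝ)..2, (x : ℂ) ^ (k + 1) * slopeMean ψ ε γ F x‖ ≤
      D * ((2 * γ) ^ k / k.factorial) *
        ∫ ξ in (-ε)..ε, ∫ s in (-γ)..γ, ‖primRadon F 0 ξ s‖ := by
  have hγ0 : 0 ≤ γ := by nlinarith [sq_nonneg ε]
  have hc : ∀ j, Continuous fun ξ => primRadon F j ξ γ := fun j =>
    continuous_primRadon_comp hF j continuous_id continuous_const
  have hcd : Continuous (iteratedDeriv (k + 1) ψ) :=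
    hψ.continuous_iteratedDeriv _ (by exact_mod_cast le_top)
  have hcA : Continuous fun ξ => ∫ s in (-γ)..γ, ‖primRadon F 0 ξ s‖ :=
    intervalIntegral.continuous_parametric_intervalIntegral_of_continuous'
      (f := fun ξ s => ‖primRadon F 0 ξ s‖) (continuous_primRadon hF 0).norm _ _
  have hD0 : 0 ≤ D := (abs_nonneg _).trans (hD 0)
  rw [integral_pow_mul_slopeMean hF hψ hs γ (k + 1), norm_mul, norm_pow, norm_neg, norm_one,
    one_pow, one_mul, ← intervalIntegral.integral_const_mul]
  refine (intervalIntegral.norm_integral_le_integral_norm (by linarith)).trans ?_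
  refine intervalIntegral.integral_mono_on (by linarith)
    ((((Complex.continuous_ofReal.comp hcd).mul (hc (k + 1))).norm).intervalIntegrable _ _)
    ((by fun_prop : Continuous _).intervalIntegrable _ _) fun ξ hξ => ?_
  rw [norm_mul, Complex.norm_real, Real.norm_eq_abs]
  have hξ2 : ξ ^ 2 ≤ 4 * γ := (sq_le_sq' hξ.1 hξ.2).trans hγ
  have h := norm_primRadon_le hF h0 hξ2 k γ (by linarith) le_rfl
  rw [← two_mul] at h
  calc _ ≤ D * ((∫ s in (-γ)..γ, ‖primRadon F 0 ξ s‖) * ((2 * γ) ^ k / k.factorial)) := by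
        gcongr
        exact hD ξ
    _ = _ := by ring

end

/-! ### Vertical means as slope means; dilated mollifiers. -/

theorem vmean_eq_slopeMean {φ : ℝ → ℝ} (hφ : IsMollifier φ) {ε : ℝ} (hε : 0 < ε) (γ : ℝ)
    (f : EuclideanSpace ℝ (Fin 2) → ℂ) (x : ℝ) :
    vmean φ ε γ f x = slopeMean (dilate φ ε) ε γ (fun x y => f !₂[x, y]) x := by
  have hz : ∀ t : ℝ, 1 ≤ |t| → φ t = 0 := fun t ht => by
    simpa using iteratedDeriv_eq_zero_of_abs_ge hφ.smooth hφ.supp 0 ht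
  have hdz : ∀ r t : ℝ, 0 < r → r ≤ |t| → dilate φ r t = 0 := fun r t hr ht => by
    rw [dilate, hz, mul_zero]
    rwa [abs_div, abs_of_pos hr, one_le_div hr]
  have hright : slopeMean (dilate φ ε) ε γ (fun x y => f !₂[x, y]) x =
      ∫ ξ, (dilate φ ε ξ : ℂ) * f !₂[x, γ + ξ * x] := by
    refine intervalIntegral.integral_eq_integral_of_support_subset fun ξ hξ => ?_
    have : |ξ| < ε := not_le.1 fun h => hξ (by simp [hdz ε ξ hε h])
    exact ⟨(abs_lt.1 this).1, (abs_lt.1 this).2.le⟩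
  rw [hright, vmean]
  split_ifs with hx
  · subst hx
    simp only [mul_zero, add_zero, integral_mul_const]
    rw [integral_complex_ofReal]
    have : ∫ ξ, dilate φ ε ξ = 1 := by
      simp only [dilate]
      rw [integral_const_mul, Measure.integral_comp_div, hφ.integral_eq, abs_of_pos hε]
      simp [hε.ne']
    simp [this]
  · have hr : 0 < ε * |x| := mul_pos hε (abs_pos.2 hx)
    rw [setIntegral_eq_integral_of_forall_compl_eq_zero]
    · have hsub := Measure.integral_comp_mul_right
        (fun y => f !₂[x, γ + y] * (dilate φ (ε * |x|) (γ - (γ + y)) : ℂ)) x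
      rw [integral_add_left_eq_self
        (fun y => f !₂[x, y] * (dilate φ (ε * |x|) (γ - y) : ℂ)) γ] at hsub
      have hx' : (0 : ℝ) < |x| := abs_pos.2 hx
      rw [abs_inv, eq_comm, inv_smul_eq_iff₀ hx'.ne'] at hsub
      rw [hsub, ← integral_smul]
      refine integral_congr_ae (Filter.Eventually.of_forall fun ξ => ?_)
      -- The factor $|x|^{-1}$ cancels the Jacobian; evenness of `φ` removes the sign of `x`.
      have hd : dilate φ (ε * |x|) (γ - (γ + ξ * x)) = |x|⁻¹ * dilate φ ε ξ := by
        have h1 : φ ((γ - (γ + ξ * x)) / (ε * |x|)) = φ (ξ / ε) := by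
          rcases lt_or_gt_of_ne hx with h | h
          · rw [abs_of_neg h]
            congr 1
            field_simp
            ring
          · rw [abs_of_pos h, ← hφ.even]
            congr 1
            field_simp
            ring
        rw [dilate, h1, dilate, mul_inv]
        ring
      simp only [hd, Complex.real_smul]
      push_cast
      have : ((|x| : ℝ) : ℂ) ≠ 0 := by exact_mod_cast hx'.ne'
      field_simp
    · intro y hy
      rw [hdz _ _ hr, Complex.ofReal_zero, mul_zero]
      rw [abs_sub_comm]
      exact (not_le.1 hy).le

section

variable {φ : ℝ → ℝ} {ε : ℝ}

theorem contDiff_dilate (hφ : IsMollifier φ) : ContDiff ℝ ∞ (dilate φ ε) := by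
  have := hφ.smooth
  unfold dilate
  fun_prop

theorem tsupport_dilate_subset (hφ : IsMollifier φ) (hε : 0 < ε) :
    tsupport (dilate φ ε) ⊆ Set.Icc (-ε) ε := by
  refine closure_minimal (fun t ht => abs_le.1 (not_lt.1 fun h => ht ?_)) isClosed_Icc
  have := iteratedDeriv_eq_zero_of_abs_ge hφ.smooth hφ.supp 0 (t := t / ε)
    (by rw [abs_div, abs_of_pos hε, one_le_div hε]; exact h.le)
  rw [iteratedDeriv_zero] at this
  rw [dilate, this, mul_zero]

theorem abs_iteratedDeriv_dilate_le (hφ : IsMollifier φ) (hε : 0 < ε) {k : ℕ} {D : ℝ}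
    (hD : ∀ t, |iteratedDeriv k φ t| ≤ D) (t : ℝ) :
    |iteratedDeriv k (dilate φ ε) t| ≤ D / ε ^ (k + 1) := by
  have h1 : dilate φ ε = fun t => ε⁻¹ * φ (ε⁻¹ * t) := by
    funext t
    rw [dilate, div_eq_inv_mul]
  have h2 := congrFun (iteratedDeriv_comp_const_mul
    (hφ.smooth.of_le (by exact_mod_cast le_top) : ContDiff ℝ k φ) ε⁻¹) t
  rw [h1, iteratedDeriv_const_mul_field, h2]
  simp only [abs_mul, abs_pow, abs_inv, abs_of_pos hε]
  rw [div_eq_mul_inv, pow_succ, mul_inv, ← inv_pow]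
  have := hD (ε⁻¹ * t)
  calc ε⁻¹ * ((ε⁻¹) ^ k * |iteratedDeriv k φ (ε⁻¹ * t)|) ≤ ε⁻¹ * ((ε⁻¹) ^ k * D) := by gcongr
    _ = _ := by ring

/-- For $H=0$ any finite bound suffices, so derivatives of every order of one fixed mollifier can be
used. -/
theorem exists_abs_iteratedDeriv_le (hφ : IsMollifier φ) (k : ℕ) :
    ∃ D, ∀ t, |iteratedDeriv k φ t| ≤ D := by
  have hc : Continuous (iteratedDeriv k φ) :=
    hφ.smooth.continuous_iteratedDeriv k (by exact_mod_cast le_top)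
  have hcs : HasCompactSupport (iteratedDeriv k φ) := by
    refine HasCompactSupport.intro (isCompact_Icc (a := (-1 : ℝ)) (b := 1)) fun t ht => ?_
    refine iteratedDeriv_eq_zero_of_abs_ge hφ.smooth hφ.supp k ?_
    by_contra h
    exact ht (abs_le.1 (not_le.1 h).le)
  exact hcs.exists_bound_of_continuous hc

theorem dilate_nonneg (hφ : IsMollifier φ) (hε : 0 < ε) (t : ℝ) : 0 ≤ dilate φ ε t :=
  mul_nonneg (inv_nonneg.2 hε.le) (hφ.nonneg _)

theorem integral_dilate (hφ : IsMollifier φ) (hε : 0 < ε) :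
    ∫ t in (-ε)..ε, dilate φ ε t = 1 := by
  rw [intervalIntegral.integral_eq_integral_of_support_subset]
  · simp only [dilate]
    rw [integral_const_mul, Measure.integral_comp_div, hφ.integral_eq, abs_of_pos hε]
    simp [hε.ne']
  · intro t ht
    have : |t| < ε := not_le.1 fun h => ht (by
      simpa using iteratedDeriv_eq_zero_of_abs_ge (contDiff_dilate hφ)
        (tsupport_dilate_subset hφ hε) 0 h)
    exact ⟨(abs_lt.1 this).1, (abs_lt.1 this).2.le⟩

theorem norm_integral_dilate_mul_le (hφ : IsMollifier φ) (hε : 0 < ε) {u : ℝ → ℂ} (hu : Continuous u)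
    {B : ℝ} (hB : ∀ t ∈ Set.Icc (-ε) ε, ‖u t‖ ≤ B) :
    ‖∫ t in (-ε)..ε, (dilate φ ε t : ℂ) * u t‖ ≤ B := by
  have hc : Continuous (dilate φ ε) := (contDiff_dilate hφ).continuous
  refine (intervalIntegral.norm_integral_le_integral_norm (by linarith)).trans ?_
  calc ∫ t in (-ε)..ε, ‖(dilate φ ε t : ℂ) * u t‖ ≤ ∫ t in (-ε)..ε, dilate φ ε t * B := by
        refine intervalIntegral.integral_mono_on (by linarith)
          ((by fun_prop : Continuous _).intervalIntegrable _ _)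
          ((by fun_prop : Continuous _).intervalIntegrable _ _) fun t ht => ?_
        rw [norm_mul, Complex.norm_real, Real.norm_eq_abs, abs_of_nonneg (dilate_nonneg hφ hε t)]
        exact mul_le_mul_of_nonneg_left (hB t ht) (dilate_nonneg hφ hε t)
    _ = B := by rw [intervalIntegral.integral_mul_const, integral_dilate hφ hε, one_mul]

end

/-! ### Hölder functions supported in the parabolic region, and their slope means. -/

section

variable {f : EuclideanSpace ℝ (Fin 2) → ℂ}

theorem continuous_uncurry_coord (hf : Continuous f) :
    Continuous (Function.uncurry fun x y : ℝ => f !₂[x, y]) := by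
  refine hf.comp ?_
  fun_prop

theorem eq_zero_of_le_sq (hf : Continuous f) (hs : tsupport f ⊆ parabola) (x t : ℝ)
    (ht : t ≤ x ^ 2) : f !₂[x, t] = 0 := by
  have hlt : ∀ t : ℝ, t < x ^ 2 → f !₂[x, t] = 0 := by
    intro t ht
    by_contra h
    have := hs (subset_tsupport f h)
    simp [parabola] at this
    linarith
  have hcl : IsClosed {t : ℝ | f !₂[x, t] = 0} :=
    isClosed_eq (hf.comp (by fun_prop)) continuous_const
  have := hcl.closure_subset_iff.2 (fun t (ht : t ∈ Set.Iio (x ^ 2)) => hlt t ht)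
  rw [closure_Iio] at this
  exact this ht

theorem norm_sub_le_of_holderWith {C₀ α : ℝ≥0} (hf : HolderWith C₀ α f) (x y x' y' : ℝ) :
    ‖f !₂[x, y] - f !₂[x', y']‖ ≤ C₀ * (|x - x'| + |y - y'|) ^ (α : ℝ) := by
  have h := hf.dist_le (!₂[x, y] : EuclideanSpace ℝ (Fin 2)) !₂[x', y']
  rw [dist_eq_norm] at h
  refine h.trans ?_
  gcongr
  rw [EuclideanSpace.dist_eq]
  refine Real.sqrt_le_iff.2 ⟨by positivity, ?_⟩
  simp only [Fin.sum_univ_two, Real.dist_eq]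
  simp
  nlinarith [abs_nonneg (x - x'), abs_nonneg (y - y'), sq_abs (x - x'), sq_abs (y - y')]

theorem rpow_le_self_of_one_le {a α : ℝ} (ha : 1 ≤ a) (h1 : α ≤ 1) : a ^ α ≤ a := by
  simpa using Real.rpow_le_rpow_of_exponent_le ha h1

/-- Comparison with the zero at $(x,0)$ turns the seminorm into a sup bound; $\gamma+\xi x\le3$ on
the lines used, where $|x|\le2$. -/
theorem norm_le_of_holderWith {C₀ α : ℝ≥0} (hα : α ≤ 1) (hα0 : 0 < α) (hf : HolderWith C₀ α f)
    (hs : tsupport f ⊆ parabola) (x y : ℝ) (hy : y ≤ 3) :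
    ‖f !₂[x, y]‖ ≤ 3 * C₀ := by
  have hc := hf.continuous hα0
  rcases le_total y 0 with h | h
  · rw [eq_zero_of_le_sq hc hs x y (h.trans (sq_nonneg x)), norm_zero]
    positivity
  · have h1 := norm_sub_le_of_holderWith hf x y x 0
    rw [eq_zero_of_le_sq hc hs x 0 (sq_nonneg x), sub_zero] at h1
    refine h1.trans ?_
    rw [mul_comm]
    gcongr
    simp only [sub_self, abs_zero, zero_add, sub_zero]
    rw [abs_of_nonneg h]
    calc y ^ (α : ℝ) ≤ 3 ^ (α : ℝ) := by gcongr
      _ ≤ 3 := rpow_le_self_of_one_le (by norm_num) (by exact_mod_cast hα)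

theorem radon_eq_primRadon (hf : Continuous f) (hs : tsupport f ⊆ parabola) {ξ η : ℝ}
    (hξ : |ξ| ≤ 1) (hη : η ≤ 1) : radon f ξ η = primRadon (fun x y => f !₂[x, y]) 0 ξ η := by
  rw [radon, primRadon, intervalIntegral.integral_eq_integral_of_support_subset]
  · rfl
  · intro x hx
    -- For $|x|\ge2$ one has $\xi x+\eta\le|x|+1\le x^2$, so truncation at $2$ loses nothing.
    have : |x| < 2 := not_le.1 fun h => hx (eq_zero_of_le_sq hf hs _ _ (by
      have h1 : ξ * x ≤ |x| := by
        calc ξ * x ≤ |ξ * x| := le_abs_self _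
          _ = |ξ| * |x| := abs_mul _ _
          _ ≤ 1 * |x| := by gcongr
          _ = |x| := one_mul _
      have := sq_abs x
      nlinarith))
    exact ⟨(abs_lt.1 this).1, (abs_lt.1 this).2.le⟩

/-- Lines near a given one meet the parabolic region over a common bounded $x$-interval. Continuity
is needed because `IsDataNorm` only concerns continuous data. -/
theorem continuous_radon (hf : Continuous f) (hs : tsupport f ⊆ parabola) :
    Continuous fun p : ℝ × ℝ => radon f p.1 p.2 := by
  rw [continuous_iff_continuousAt]
  intro p
  set R : ℝ := |p.1| + |p.2| + 3 with hR
  have hloc : ∀ q ∈ Metric.ball p 1, radon f q.1 q.2 =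
      ∫ x in (-R)..R, f !₂[x, q.1 * x + q.2] := by
    intro q hq
    rw [Metric.mem_ball, Prod.dist_eq, max_lt_iff, Real.dist_eq, Real.dist_eq] at hq
    have h1 : |q.1| < |p.1| + 1 := by linarith [abs_sub_abs_le_abs_sub q.1 p.1]
    have h2 : |q.2| < |p.2| + 1 := by linarith [abs_sub_abs_le_abs_sub q.2 p.2]
    rw [radon, intervalIntegral.integral_eq_integral_of_support_subset]
    intro x hx
    have : |x| < R := not_le.1 fun h => hx (eq_zero_of_le_sq hf hs _ _ (by
      have h3 : q.1 * x ≤ |q.1| * |x| := by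
        rw [← abs_mul]
        exact le_abs_self _
      have h4 := le_abs_self q.2
      have h5 := sq_abs x
      have h6 := abs_nonneg p.1
      have h7 := abs_nonneg p.2
      have h8 : |q.1| * |x| ≤ (|p.1| + 1) * |x| := by gcongr
      nlinarith))
    exact ⟨(abs_lt.1 this).1, (abs_lt.1 this).2.le⟩
  have hcont : Continuous fun q : ℝ × ℝ => ∫ x in (-R)..R, f !₂[x, q.1 * x + q.2] := by
    refine intervalIntegral.continuous_parametric_intervalIntegral_of_continuous'
      (f := fun (q : ℝ × ℝ) (x : ℝ) => f !₂[x, q.1 * x + q.2]) ?_ _ _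
    exact (continuous_uncurry_coord hf).comp
      (by fun_prop : Continuous fun r : (ℝ × ℝ) × ℝ => (r.2, r.1.1 * r.2 + r.1.2))
  refine hcont.continuousAt.congr ?_
  filter_upwards [Metric.ball_mem_nhds p one_pos] with q hq
  exact (hloc q hq).symm

variable {φ : ℝ → ℝ} {ε γ : ℝ}

theorem continuous_slopeMean (hf : Continuous f) (hφ : IsMollifier φ) :
    Continuous (slopeMean (dilate φ ε) ε γ fun x y => f !₂[x, y]) := by
  have hc : Continuous (dilate φ ε) := (contDiff_dilate hφ).continuous
  refine intervalIntegral.continuous_parametric_intervalIntegral_of_continuous'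
    (f := fun x ξ => (dilate φ ε ξ : ℂ) * f !₂[x, γ + ξ * x]) ?_ _ _
  exact (Complex.continuous_ofReal.comp (hc.comp continuous_snd)).mul
    ((continuous_uncurry_coord hf).comp
      (by fun_prop : Continuous fun r : ℝ × ℝ => (r.1, γ + r.2 * r.1)))

theorem slopeMean_eq_zero (hf : Continuous f) (hs : tsupport f ⊆ parabola) {ψ : ℝ → ℝ}
    (hε : 0 ≤ ε) (hε1 : ε ≤ 1) (hγ : γ ≤ 1) {x : ℝ} (hx : 2 ≤ |x|) :
    slopeMean ψ ε γ (fun x y => f !₂[x, y]) x = 0 := by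
  have : slopeMean ψ ε γ (fun x y => f !₂[x, y]) x = ∫ ξ in (-ε)..ε, (0 : ℂ) := by
    refine intervalIntegral.integral_congr fun ξ hξ => ?_
    rw [Set.uIcc_of_le (by linarith)] at hξ
    have h1 : |ξ| ≤ 1 := (abs_le.2 hξ).trans hε1
    have h2 : ξ * x ≤ |x| := by
      calc ξ * x ≤ |ξ * x| := le_abs_self _
        _ = |ξ| * |x| := abs_mul _ _
        _ ≤ 1 * |x| := by gcongr
        _ = |x| := one_mul _
    have h3 := sq_abs x
    simp only [eq_zero_of_le_sq hf hs x (γ + ξ * x) (by nlinarith), mul_zero]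
  simpa using this

theorem norm_slopeMean_le {C₀ α : ℝ≥0} (hα : α ≤ 1) (hα0 : 0 < α) (hf : HolderWith C₀ α f)
    (hs : tsupport f ⊆ parabola) (hφ : IsMollifier φ) (hε : 0 < ε) (hε1 : ε ≤ 1) (hγ : γ ≤ 1)
    (x : ℝ) : ‖slopeMean (dilate φ ε) ε γ (fun x y => f !₂[x, y]) x‖ ≤ 3 * C₀ := by
  have hc := hf.continuous hα0
  rcases le_total 2 |x| with h | h
  · rw [slopeMean_eq_zero hc hs hε.le hε1 hγ h, norm_zero]
    positivity
  · refine norm_integral_dilate_mul_le hφ hε ((continuous_uncurry_coord hc).comp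
      (by fun_prop : Continuous fun ξ : ℝ => (x, γ + ξ * x))) fun ξ hξ => ?_
    refine norm_le_of_holderWith hα hα0 hf hs _ _ ?_
    have h1 : |ξ| ≤ 1 := (abs_le.2 hξ).trans hε1
    have h2 : ξ * x ≤ |x| := by
      calc ξ * x ≤ |ξ * x| := le_abs_self _
        _ = |ξ| * |x| := abs_mul _ _
        _ ≤ 1 * |x| := by gcongr
        _ = |x| := one_mul _
    linarith

/-- A shift of $x$ by $h$ along a line of slope at most $1$ moves the point by at most $2h$, and
$\psi$ has mass one: the Hölder constant does not depend on $\varepsilon$ or $\varphi$. -/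
theorem norm_slopeMean_sub_le {C₀ α : ℝ≥0} (hα : α ≤ 1) (hα0 : 0 < α) (hf : HolderWith C₀ α f)
    (hφ : IsMollifier φ) (hε : 0 < ε) (hε1 : ε ≤ 1) {h : ℝ} (h0 : 0 ≤ h) (x : ℝ) :
    ‖slopeMean (dilate φ ε) ε γ (fun x y => f !₂[x, y]) (x + h) -
      slopeMean (dilate φ ε) ε γ (fun x y => f !₂[x, y]) x‖ ≤ 2 * C₀ * h ^ (α : ℝ) := by
  have hc := hf.continuous hα0
  have hd : Continuous (dilate φ ε) := (contDiff_dilate hφ).continuous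
  have hcx : ∀ x : ℝ, Continuous fun ξ : ℝ => f !₂[x, γ + ξ * x] := fun x =>
    (continuous_uncurry_coord hc).comp (by fun_prop : Continuous fun ξ : ℝ => (x, γ + ξ * x))
  have hi : ∀ x : ℝ, IntervalIntegrable (fun ξ : ℝ => (dilate φ ε ξ : ℂ) * f !₂[x, γ + ξ * x])
      volume (-ε) ε := fun x =>
    ((Complex.continuous_ofReal.comp hd).mul (hcx x)).intervalIntegrable _ _
  rw [slopeMean, slopeMean, ← intervalIntegral.integral_sub (hi _) (hi _)]
  simp only [← mul_sub]
  refine norm_integral_dilate_mul_le hφ hε ((hcx _).sub (hcx _)) fun ξ hξ => ?_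
  refine (norm_sub_le_of_holderWith hf _ _ _ _).trans ?_
  have h1 : |ξ| ≤ 1 := (abs_le.2 hξ).trans hε1
  have h2 : |x + h - x| + |γ + ξ * (x + h) - (γ + ξ * x)| ≤ 2 * h := by
    rw [show x + h - x = h by ring, show γ + ξ * (x + h) - (γ + ξ * x) = ξ * h by ring, abs_mul,
      abs_of_nonneg h0]
    nlinarith
  calc (C₀ : ℝ) * _ ^ (α : ℝ) ≤ C₀ * (2 * h) ^ (α : ℝ) := by gcongr
    _ = C₀ * (2 ^ (α : ℝ) * h ^ (α : ℝ)) := by rw [Real.mul_rpow (by norm_num) h0]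
    _ ≤ C₀ * (2 * h ^ (α : ℝ)) := by
        gcongr
        exact rpow_le_self_of_one_le (by norm_num) (by exact_mod_cast hα)
    _ = _ := by ring

end

/-! ### Fourier coefficients: Parseval, high and low frequencies. -/

/-- The integral of `e^{-inx} g(x)` over `[-π, π]`. -/
noncomputable def circleCoeff (g : ℝ → ℂ) (n : ℤ) : ℂ :=
  ∫ x in (-Real.pi)..Real.pi, Complex.exp (-(n * x * Complex.I)) * g x

theorem hasSum_sq_circleCoeff {g : ℝ → ℂ} (hg : Continuous g) :
    HasSum (fun n : ℤ => ‖circleCoeff g n‖ ^ 2)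
      (2 * Real.pi * ∫ x in (-Real.pi)..Real.pi, ‖g x‖ ^ 2) := by
  have hab : -Real.pi < Real.pi := by linarith [Real.pi_pos]
  have hL : MemLp g 2 (volume.restrict (Set.Ioc (-Real.pi) Real.pi)) := by
    obtain ⟨B, hB⟩ := (isCompact_Icc (a := -Real.pi) (b := Real.pi)).exists_bound_of_continuousOn
      hg.continuousOn
    refine MemLp.of_bound hg.aestronglyMeasurable B ?_
    filter_upwards [ae_restrict_mem measurableSet_Ioc] with x hx
    exact hB x (Set.Ioc_subset_Icc_self hx)
  have h := (hasSum_sq_fourierCoeffOn hab hL).mul_left ((2 * Real.pi) ^ 2)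
  have e1 : (fun n : ℤ => ‖circleCoeff g n‖ ^ 2) =
      fun n => (2 * Real.pi) ^ 2 * ‖fourierCoeffOn hab g n‖ ^ 2 := by
    funext n
    rw [fourierCoeffOn_eq_integral, norm_smul, mul_pow ‖_‖, ← mul_assoc]
    have h1 : (2 * Real.pi) ^ 2 * ‖1 / (Real.pi - -Real.pi)‖ ^ 2 = 1 := by
      rw [Real.norm_eq_abs, sq_abs]
      have := Real.pi_pos.ne'
      field_simp
      norm_num
    rw [h1, one_mul, circleCoeff]
    congr 2
    refine intervalIntegral.integral_congr fun x _ => ?_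
    simp only [fourier_coe_apply, smul_eq_mul]
    congr 2
    have := Complex.ofReal_ne_zero.2 Real.pi_pos.ne'
    push_cast
    field_simp
    ring
  have e2 : 2 * Real.pi * ∫ x in (-Real.pi)..Real.pi, ‖g x‖ ^ 2 =
      (2 * Real.pi) ^ 2 * (Real.pi - -Real.pi)⁻¹ • ∫ x in (-Real.pi)..Real.pi, ‖g x‖ ^ 2 := by
    rw [smul_eq_mul]
    have := Real.pi_pos.ne'
    field_simp
    ring
  rw [e1, e2]
  exact h

theorem support_subset_Ioc {E : Type*} [Zero E] {G : ℝ → E} (hG : ∀ x, 2 ≤ |x| → G x = 0) {a b : ℝ}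
    (ha : a ≤ -2) (hb : 2 ≤ b) : Function.support G ⊆ Set.Ioc a b := by
  intro x hx
  have : |x| < 2 := not_le.1 fun h => hx (hG x h)
  rw [abs_lt] at this
  constructor <;> linarith

/-- As $2+1<\pi$, the shifted support stays inside $[-\pi,\pi]$ and no periodisation is needed. -/
theorem circleCoeff_translate {g : ℝ → ℂ} (hs : ∀ x, 2 ≤ |x| → g x = 0) {h : ℝ} (h0 : 0 ≤ h)
    (h1 : h ≤ 1) (n : ℤ) :
    circleCoeff (fun x => g (x + h)) n = Complex.exp (n * h * Complex.I) * circleCoeff g n := by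
  have hpi := Real.pi_gt_three
  have hG : ∀ x : ℝ, 2 ≤ |x| → Complex.exp (-(n * x * Complex.I)) * g x = 0 := fun x hx => by
    rw [hs x hx, mul_zero]
  simp only [circleCoeff]
  rw [intervalIntegral.integral_eq_integral_of_support_subset
    (support_subset_Ioc hG (by linarith) (by linarith)),
    ← intervalIntegral.integral_eq_integral_of_support_subset
    (support_subset_Ioc hG (a := -Real.pi + h) (b := Real.pi + h) (by linarith) (by linarith)),
    ← intervalIntegral.integral_comp_add_right
      (fun x : ℝ => Complex.exp (-(n * x * Complex.I)) * g x), ← intervalIntegral.integral_const_mul]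
  refine intervalIntegral.integral_congr fun x _ => ?_
  rw [← mul_assoc, ← Complex.exp_add]
  congr 2
  push_cast
  ring

theorem normSq_exp_sub_one (θ : ℝ) :
    ‖Complex.exp (θ * Complex.I) - 1‖ ^ 2 = 2 - 2 * Real.cos θ := by
  rw [← Complex.normSq_eq_norm_sq, Complex.normSq_apply]
  simp only [Complex.sub_re, Complex.sub_im, Complex.exp_ofReal_mul_I_re,
    Complex.exp_ofReal_mul_I_im, Complex.one_re, Complex.one_im]
  nlinarith [Real.sin_sq_add_cos_sq θ]

theorem sum_circleCoeff_translate_le {g : ℝ → ℂ} (hg : Continuous g) (hs : ∀ x, 2 ≤ |x| → g x = 0)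
    {h D : ℝ} (h0 : 0 ≤ h) (h1 : h ≤ 1) (hD : ∀ x, ‖g (x + h) - g x‖ ≤ D) (S : Finset ℤ) :
    ∑ n ∈ S, (2 - 2 * Real.cos (n * h)) * ‖circleCoeff g n‖ ^ 2 ≤ 4 * Real.pi ^ 2 * D ^ 2 := by
  have hd : Continuous fun x => g (x + h) - g x := by fun_prop
  have hP := hasSum_sq_circleCoeff hd
  have hc : ∀ n : ℤ, ‖circleCoeff (fun x => g (x + h) - g x) n‖ ^ 2 =
      (2 - 2 * Real.cos (n * h)) * ‖circleCoeff g n‖ ^ 2 := by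
    intro n
    have : circleCoeff (fun x => g (x + h) - g x) n =
        (Complex.exp (((n * h : ℝ) : ℂ) * Complex.I) - 1) * circleCoeff g n := by
      rw [sub_mul, one_mul]
      push_cast
      rw [← circleCoeff_translate hs h0 h1]
      simp only [circleCoeff, mul_sub]
      rw [intervalIntegral.integral_sub]
      · exact (by fun_prop : Continuous _).intervalIntegrable _ _
      · exact (by fun_prop : Continuous _).intervalIntegrable _ _
    rw [this, norm_mul, mul_pow, normSq_exp_sub_one]
  simp only [hc] at hP
  refine (sum_le_hasSum S (fun n _ => ?_) hP).trans ?_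
  · rw [← hc]; positivity
  · have hpi := Real.pi_pos
    have : ∫ x in (-Real.pi)..Real.pi, ‖g (x + h) - g x‖ ^ 2 ≤
        ∫ x in (-Real.pi)..Real.pi, D ^ 2 := by
      refine intervalIntegral.integral_mono_on (by linarith)
        ((by fun_prop : Continuous _).intervalIntegrable _ _) (by simp) fun x _ => ?_
      gcongr
      exact hD x
    rw [intervalIntegral.integral_const, smul_eq_mul] at this
    calc _ ≤ 2 * Real.pi * ((Real.pi - -Real.pi) * D ^ 2) := by gcongr
      _ = _ := by ring

/-- The high Fourier coefficients of a Hölder continuous function. -/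
theorem sum_high_circleCoeff_le {g : ℝ → ℂ} (hg : Continuous g) (hs : ∀ x, 2 ≤ |x| → g x = 0)
    {A α r : ℝ} (hα : 0 ≤ α) (hA : 0 ≤ A) (hr : 0 < r) (hr1 : r ≤ 1)
    (hH : ∀ h x, 0 ≤ h → h ≤ 1 → ‖g (x + h) - g x‖ ≤ A * h ^ α) (S : Finset ℤ)
    (hS : ∀ n ∈ S, 2 ≤ |(n : ℝ)| * r) :
    ∑ n ∈ S, ‖circleCoeff g n‖ ^ 2 ≤ 4 * Real.pi ^ 2 * (A * r ^ α) ^ 2 := by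
  -- A single shift may have $e^{inh}=1$. Averaged over $[0,r]$ the weight is $2-2\sin(nr)/(nr)\ge1$
  -- as soon as $|n|r\ge2$.
  have h1 : ∫ h in (0:ℝ)..r, ∑ n ∈ S, (2 - 2 * Real.cos (n * h)) * ‖circleCoeff g n‖ ^ 2 ≤
      ∫ h in (0:ℝ)..r, 4 * Real.pi ^ 2 * (A * r ^ α) ^ 2 := by
    refine intervalIntegral.integral_mono_on hr.le
      ((by fun_prop : Continuous _).intervalIntegrable _ _) (by simp) fun h hh => ?_
    refine sum_circleCoeff_translate_le hg hs hh.1 (hh.2.trans hr1) (fun x => ?_) S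
    refine (hH h x hh.1 (hh.2.trans hr1)).trans ?_
    have := hh.1
    have := hh.2
    gcongr
  rw [intervalIntegral.integral_const, smul_eq_mul, sub_zero, intervalIntegral.integral_finsetSum
    (fun n _ => (by fun_prop : Continuous _).intervalIntegrable _ _)] at h1
  have h2 : ∀ n ∈ S, r * ‖circleCoeff g n‖ ^ 2 ≤
      ∫ h in (0:ℝ)..r, (2 - 2 * Real.cos (n * h)) * ‖circleCoeff g n‖ ^ 2 := by
    intro n hn
    have hn2 := hS n hn
    have hn0 : (n : ℝ) ≠ 0 := by
      rintro h
      rw [h] at hn2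
      norm_num at hn2
    rw [intervalIntegral.integral_mul_const]
    gcongr
    rw [intervalIntegral.integral_sub (by simp)
      ((by fun_prop : Continuous _).intervalIntegrable _ _), intervalIntegral.integral_const_mul,
      intervalIntegral.integral_comp_mul_left (fun x => Real.cos x) hn0, integral_cos]
    simp only [intervalIntegral.integral_const, mul_zero, Real.sin_zero, sub_zero, smul_eq_mul]
    have h3 : (n : ℝ)⁻¹ * Real.sin (n * r) ≤ r / 2 := by
      refine (le_abs_self _).trans ?_
      rw [abs_mul, abs_inv]
      have hnp : 0 < |(n : ℝ)| := abs_pos.2 hn0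
      calc |(n : ℝ)|⁻¹ * |Real.sin (n * r)| ≤ |(n : ℝ)|⁻¹ * 1 := by
            gcongr; exact Real.abs_sin_le_one _
        _ ≤ r / 2 := by
            rw [mul_one, inv_le_iff_one_le_mul₀ hnp]
            linarith
    linarith
  have h3 := (Finset.sum_le_sum h2).trans h1
  rw [← Finset.mul_sum] at h3
  exact le_of_mul_le_mul_left h3 hr

/-- The low Fourier coefficients are controlled by the moments. -/
theorem norm_circleCoeff_le {g : ℝ → ℂ} (hg : Continuous g) (hs : ∀ x, 2 ≤ |x| → g x = 0)
    {B : ℝ} (hB : ∀ x, ‖g x‖ ≤ B) (n : ℤ) (m : ℕ) (hm : 4 * |(n : ℝ)| ≤ m + 1) :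
    ‖circleCoeff g n‖ ≤
      (∑ k ∈ Finset.range m, |(n : ℝ)| ^ k / k.factorial *
        ‖∫ x in (-2 : ℝ)..2, (x : ℂ) ^ k * g x‖) +
      8 * B * ((2 * |(n : ℝ)|) ^ m / m.factorial) := by
  have hpi := Real.pi_gt_three
  have hB0 : 0 ≤ B := (norm_nonneg _).trans (hB 0)
  have hG : ∀ x : ℝ, 2 ≤ |x| → Complex.exp (-(n * x * Complex.I)) * g x = 0 := fun x hx => by
    rw [hs x hx, mul_zero]
  have e1 : circleCoeff g n = ∫ x in (-2 : ℝ)..2, Complex.exp (-(n * x * Complex.I)) * g x := by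
    rw [circleCoeff, intervalIntegral.integral_eq_integral_of_support_subset
      (support_subset_Ioc hG (by linarith) (by linarith)),
      intervalIntegral.integral_eq_integral_of_support_subset
      (support_subset_Ioc hG le_rfl le_rfl)]
  have e2 : circleCoeff g n = (∑ k ∈ Finset.range m, (-(n * Complex.I)) ^ k / k.factorial *
        ∫ x in (-2 : ℝ)..2, (x : ℂ) ^ k * g x) +
      ∫ x in (-2 : ℝ)..2, (Complex.exp (-(n * x * Complex.I)) -
        ∑ k ∈ Finset.range m, (-(n * x * Complex.I)) ^ k / k.factorial) * g x := by
    have : ∀ k ∈ Finset.range m, (-(n * Complex.I)) ^ k / k.factorial *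
        (∫ x in (-2 : ℝ)..2, (x : ℂ) ^ k * g x) =
        ∫ x in (-2 : ℝ)..2, (-(n * x * Complex.I)) ^ k / k.factorial * g x := by
      intro k _
      rw [← intervalIntegral.integral_const_mul]
      refine intervalIntegral.integral_congr fun x _ => ?_
      rw [show -(n * x * Complex.I) = -(n * Complex.I) * x by ring, mul_pow]
      ring
    rw [Finset.sum_congr rfl this, ← intervalIntegral.integral_finsetSum
      (fun k _ => (by fun_prop : Continuous _).intervalIntegrable _ _),
      ← intervalIntegral.integral_add ((by fun_prop : Continuous _).intervalIntegrable _ _)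
      ((by fun_prop : Continuous _).intervalIntegrable _ _), e1]
    refine intervalIntegral.integral_congr fun x _ => ?_
    rw [← Finset.sum_mul]
    ring
  rw [e2]
  refine (norm_add_le _ _).trans (add_le_add ?_ ?_)
  · refine (norm_sum_le _ _).trans (Finset.sum_le_sum fun k _ => ?_)
    rw [norm_mul, norm_div, norm_pow, norm_neg, norm_mul, Complex.norm_I, mul_one,
      Complex.norm_natCast, Complex.norm_intCast]
  · refine (intervalIntegral.norm_integral_le_of_norm_le_const (C := (2 * |(n : ℝ)|) ^ m /
      m.factorial * 2 * B) fun x hx => ?_).trans (le_of_eq ?_)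
    · rw [Set.uIoc_of_le (by norm_num)] at hx
      have hx2 : |x| ≤ 2 := abs_le.2 ⟨hx.1.le, hx.2⟩
      have hz : ‖-((n : ℂ) * x * Complex.I)‖ ≤ 2 * |(n : ℝ)| := by
        rw [norm_neg, norm_mul, norm_mul, Complex.norm_I, Complex.norm_intCast,
          Complex.norm_real, Real.norm_eq_abs]
        nlinarith [abs_nonneg (n : ℝ)]
      rw [norm_mul]
      -- The Taylor remainder bound requires $\|z\|/(m+1)\le1/2$; with $\|z\|\le2|n|$ this is `hm`.
      have hb := Complex.exp_bound' (x := -((n : ℂ) * x * Complex.I)) (n := m) (by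
        rw [div_le_iff₀ (by positivity)]
        push_cast
        linarith)
      refine mul_le_mul (hb.trans ?_) (hB x) (norm_nonneg _) (by positivity)
      gcongr
    · rw [show (2 - -2 : ℝ) = 4 by norm_num, abs_of_pos (by norm_num : (0 : ℝ) < 4)]
      ring

theorem eLpNorm_two_eq_sqrt {g : ℝ → ℂ} (hg : Continuous g) (hs : ∀ x, 2 ≤ |x| → g x = 0) :
    eLpNorm g 2 volume =
      ENNReal.ofReal (Real.sqrt (∫ x in (-Real.pi)..Real.pi, ‖g x‖ ^ 2)) := by
  have hpi := Real.pi_gt_three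
  have hcs : HasCompactSupport g := by
    refine HasCompactSupport.intro (isCompact_Icc (a := (-2 : ℝ)) (b := 2)) fun x hx => hs x ?_
    by_contra h
    exact hx (abs_le.1 (not_le.1 h).le)
  rw [(hg.memLp_of_hasCompactSupport hcs).eLpNorm_eq_integral_rpow_norm (by norm_num) (by norm_num),
    intervalIntegral.integral_eq_integral_of_support_subset
      (support_subset_Ioc (fun x hx => by simp [hs x hx]) (by linarith) (by linarith)),
    Real.sqrt_eq_rpow]
  norm_num

/-! ### From the data norm to moments and $L^2$ bounds. -/

section

variable {c : ℝ≥0} {nrm : ℝ → ℝ → (ℝ → ℝ → ℂ) → ℝ≥0∞} {f : EuclideanSpace ℝ (Fin 2) → ℂ}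
  {ε γ H : ℝ}

theorem rectNorm_le (hn : IsDataNorm c nrm) (hf : Continuous f) (hs : tsupport f ⊆ parabola)
    (hε : 0 < ε) (hε1 : ε < 1) (hγ : 0 < γ) (hγ1 : γ < 1) (hH : 0 ≤ H)
    (h : nrm ε γ (radon f) = ENNReal.ofReal H) :
    ∫ ξ in (-ε)..ε, ∫ s in (-γ)..γ, ‖primRadon (fun x y => f !₂[x, y]) 0 ξ s‖ ≤ c * H := by
  set G := primRadon (fun x y => f !₂[x, y]) 0
  have hG : Continuous (Function.uncurry G) := continuous_primRadon (continuous_uncurry_coord hf) 0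
  have hb := (le_max_left _ _).trans
    (hn ε γ hε hε1 hγ hγ1 (radon f) (continuous_radon hf hs))
  rw [h] at hb
  have e1 : ∫ ξ in (-ε)..ε, ∫ s in (-γ)..γ, ‖G ξ s‖ =
      ∫ p in Set.Ioc (-ε) ε ×ˢ Set.Ioo (-γ) γ, ‖Function.uncurry G p‖ := by
    rw [Measure.volume_eq_prod, setIntegral_prod,
      intervalIntegral.integral_of_le (by linarith)]
    · simp only [intervalIntegral.integral_of_le (by linarith : -γ ≤ γ), Function.uncurry_apply_pair,
        integral_Ioc_eq_integral_Ioo]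
    · exact (hG.norm.continuousOn.integrableOn_compact (isCompact_Icc.prod isCompact_Icc)).mono_set
        (Set.prod_mono Set.Ioc_subset_Icc_self Set.Ioo_subset_Icc_self)
  have hi : IntegrableOn (Function.uncurry G) (Set.Ioc (-ε) ε ×ˢ Set.Ioo (-γ) γ) :=
    (hG.continuousOn.integrableOn_compact (isCompact_Icc.prod isCompact_Icc)).mono_set
        (Set.prod_mono Set.Ioc_subset_Icc_self Set.Ioo_subset_Icc_self)
  rw [e1]
  rw [← ENNReal.ofReal_le_ofReal_iff (by positivity), ofReal_integral_norm_eq_lintegral_enorm hi,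
    ENNReal.ofReal_mul (by positivity), ENNReal.ofReal_coe_nnreal]
  refine le_trans ?_ hb
  have hms : MeasurableSet (Set.Ioc (-ε) ε ×ˢ Set.Ioo (-γ) γ) :=
    measurableSet_Ioc.prod measurableSet_Ioo
  rw [rectNorm]
  calc ∫⁻ p in Set.Ioc (-ε) ε ×ˢ Set.Ioo (-γ) γ, ‖Function.uncurry G p‖ₑ
      = ∫⁻ p in Set.Ioc (-ε) ε ×ˢ Set.Ioo (-γ) γ, ‖radon f p.1 p.2‖ₑ := by
        refine setLIntegral_congr_fun hms fun p hp => ?_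
        simp only [Function.uncurry]
        rw [radon_eq_primRadon hf hs ((abs_le.2 (Set.Ioc_subset_Icc_self hp.1)).trans hε1.le)
          (hp.2.2.le.trans hγ1.le)]
    _ ≤ _ := lintegral_mono_set fun p hp =>
        show |p.1| ≤ ε ∧ |p.2| < γ from
          ⟨abs_le.2 (Set.Ioc_subset_Icc_self hp.1), abs_lt.2 hp.2⟩

theorem sliceNorm_le (hn : IsDataNorm c nrm) (hf : Continuous f) (hs : tsupport f ⊆ parabola)
    (hε : 0 < ε) (hε1 : ε < 1) (hγ : 0 < γ) (hγ1 : γ < 1) (hH : 0 ≤ H)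
    (h : nrm ε γ (radon f) = ENNReal.ofReal H) :
    ∫ ξ in (-ε)..ε, ‖primRadon (fun x y => f !₂[x, y]) 0 ξ γ‖ ≤ c * H := by
  set G := primRadon (fun x y => f !₂[x, y]) 0
  have hG : Continuous fun ξ => G ξ γ :=
    continuous_primRadon_comp (continuous_uncurry_coord hf) 0 continuous_id continuous_const
  have hb := (le_max_right _ _).trans
    (hn ε γ hε hε1 hγ hγ1 (radon f) (continuous_radon hf hs))
  rw [h] at hb
  have hi : IntegrableOn (fun ξ => G ξ γ) (Set.Icc (-ε) ε) :=
    hG.continuousOn.integrableOn_compact isCompact_Icc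
  rw [intervalIntegral.integral_of_le (by linarith), ← integral_Icc_eq_integral_Ioc,
    ← ENNReal.ofReal_le_ofReal_iff (by positivity), ofReal_integral_norm_eq_lintegral_enorm hi,
    ENNReal.ofReal_mul (by positivity), ENNReal.ofReal_coe_nnreal]
  refine le_trans (le_of_eq ?_) hb
  refine setLIntegral_congr_fun measurableSet_Icc fun ξ hξ => ?_
  rw [radon_eq_primRadon hf hs ((abs_le.2 hξ).trans hε1.le) hγ1.le]

variable {φ : ℝ → ℝ}

/-- Truncated subtraction makes $(k-1)!=1$ at $k=0$, so one formula covers both the slice and the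
rectangle estimate. -/
theorem norm_moment_le (hn : IsDataNorm c nrm) (hf : Continuous f) (hs : tsupport f ⊆ parabola)
    (hε : 0 < ε) (hε1 : ε < 1) (hγε : ε ^ 2 / 4 ≤ γ) (hγ1 : γ < 1) (hH : 0 ≤ H)
    (h : nrm ε γ (radon f) = ENNReal.ofReal H) (hφ : IsMollifier φ) {D : ℝ} {k : ℕ}
    (hD : ∀ t, |iteratedDeriv k φ t| ≤ D) :
    ‖∫ x in (-2 : ℝ)..2, (x : ℂ) ^ k *
        slopeMean (dilate φ ε) ε γ (fun x y => f !₂[x, y]) x‖ ≤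
      D / ε ^ (k + 1) * (2 ^ k / (k - 1).factorial) * (c * H) := by
  have hγ : 0 < γ := lt_of_lt_of_le (by positivity) hγε
  have hD0 : 0 ≤ D := (abs_nonneg _).trans (hD 0)
  have hF := continuous_uncurry_coord hf
  have hdD := abs_iteratedDeriv_dilate_le hφ hε hD
  cases k with
  | zero =>
    simp only [pow_zero, one_mul, Nat.zero_sub, Nat.factorial_zero, Nat.cast_one, div_one, mul_one]
    refine (norm_integral_slopeMean_le hF hε.le (contDiff_dilate hφ)
      (tsupport_dilate_subset hφ hε) (by simpa using hdD)).trans ?_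
    simp only [zero_add, pow_one]
    gcongr
    exact sliceNorm_le hn hf hs hε hε1 hγ hγ1 hH h
  | succ k =>
    refine (norm_moment_slopeMean_le hF (eq_zero_of_le_sq hf hs) hε.le (by linarith)
      (contDiff_dilate hφ) (tsupport_dilate_subset hφ hε) k hdD).trans ?_
    rw [Nat.add_sub_cancel]
    have h2 : (2 * γ) ^ k ≤ 2 ^ (k + 1) :=
      calc (2 * γ) ^ k ≤ 2 ^ k := by gcongr; linarith
        _ ≤ 2 ^ (k + 1) := pow_le_pow_right₀ (by norm_num) (by omega)
    gcongr
    · exact intervalIntegral.integral_nonneg (by linarith) fun _ _ =>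
        intervalIntegral.integral_nonneg (by linarith) fun _ _ => norm_nonneg _
    · exact rectNorm_le hn hf hs hε hε1 hγ hγ1 hH h

/-- All moments vanish; for fixed $n$ the Taylor remainder tends to $0$ as $m\to\infty$, so every
Fourier coefficient vanishes. -/
theorem eLpNorm_vmean_eq_zero {C₀ α : ℝ≥0} (hα0 : 0 < α) (hα : α ≤ 1) (hfH : HolderWith C₀ α f)
    (hn : IsDataNorm c nrm) (hs : tsupport f ⊆ parabola)
    (hε : 0 < ε) (hε1 : ε < 1) (hγε : ε ^ 2 / 4 ≤ γ) (hγ1 : γ < 1)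
    (h : nrm ε γ (radon f) = 0) (hφ : IsMollifier φ) :
    eLpNorm (vmean φ ε γ f) 2 volume = 0 := by
  have hf := hfH.continuous hα0
  rw [funext (vmean_eq_slopeMean hφ hε γ f)]
  set g := slopeMean (dilate φ ε) ε γ (fun x y => f !₂[x, y])
  have hg : Continuous g := continuous_slopeMean hf hφ
  have hgs : ∀ x, 2 ≤ |x| → g x = 0 := fun x hx => slopeMean_eq_zero hf hs hε.le hε1.le hγ1.le hx
  have hgB : ∀ x, ‖g x‖ ≤ 3 * C₀ := norm_slopeMean_le hα hα0 hfH hs hφ hε hε1.le hγ1.le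
  have hm : ∀ k : ℕ, ∫ x in (-2 : ℝ)..2, (x : ℂ) ^ k * g x = 0 := fun k => by
    obtain ⟨D, hD⟩ := exists_abs_iteratedDeriv_le hφ k
    have := norm_moment_le hn hf hs hε hε1 hγε hγ1 le_rfl (by simpa using h) hφ hD
    simpa using this
  have hz : ∀ n : ℤ, circleCoeff g n = 0 := fun n => by
    have hlim : Filter.Tendsto (fun m : ℕ => 8 * (3 * C₀) * ((2 * |(n : ℝ)|) ^ m / m.factorial))
        Filter.atTop (nhds (8 * (3 * C₀ : ℝ) * 0)) :=
      (FloorSemiring.tendsto_pow_div_factorial_atTop _).const_mul _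
    rw [mul_zero] at hlim
    refine norm_le_zero_iff.1 (ge_of_tendsto hlim ?_)
    filter_upwards [Filter.eventually_ge_atTop ⌈4 * |(n : ℝ)|⌉₊] with m hm'
    have := norm_circleCoeff_le hg hgs hgB n m ((Nat.ceil_le.1 hm').trans (by linarith))
    simpa [hm] using this
  have hP := hasSum_sq_circleCoeff hg
  simp only [hz, norm_zero, ne_eq, OfNat.ofNat_ne_zero, not_false_eq_true, zero_pow] at hP
  have hI := hP.unique hasSum_zero
  rw [mul_eq_zero] at hI
  rw [eLpNorm_two_eq_sqrt hg hgs, hI.resolve_left (by positivity)]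
  simp

/-- Since $1/(k-1)!\le(k+1)/k!$, the growth is $(k+1)(2N)^k/k!\le e^{N+1}e^{2N}$: geometric in $N$,
uniformly in $k$. -/
theorem norm_moment_le_exp {M₀ K Q : ℝ} {N k : ℕ} (hk : k ≤ N) (hK : 1 ≤ K) (hQ : 0 ≤ Q)
    (h : M₀ ≤ K ^ (k + 1) * (N : ℝ) ^ k * (2 ^ k / (k - 1).factorial) * Q) :
    M₀ ≤ Q * K ^ (N + 1) * Real.exp (3 * (N + 1)) := by
  refine h.trans ?_
  have h1 : (1 : ℝ) / (k - 1).factorial ≤ (k + 1) / k.factorial := by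
    rcases k with _ | k
    · simp
    · rw [Nat.add_sub_cancel, Nat.factorial_succ]
      push_cast
      rw [div_le_div_iff₀ (by positivity) (by positivity)]
      nlinarith [(by positivity : (0 : ℝ) < k.factorial)]
  have h2 : (2 * N : ℝ) ^ k / k.factorial ≤ Real.exp (2 * N) :=
    Real.pow_div_factorial_le_exp _ (by positivity) k
  have h3 : (k + 1 : ℝ) ≤ Real.exp (N + 1) := by
    have : (k : ℝ) ≤ N := by exact_mod_cast hk
    linarith [Real.add_one_le_exp ((N : ℝ) + 1)]
  have hKp : K ^ (k + 1) ≤ K ^ (N + 1) := pow_le_pow_right₀ hK (by omega)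
  calc K ^ (k + 1) * (N : ℝ) ^ k * (2 ^ k / (k - 1).factorial) * Q
      = Q * K ^ (k + 1) * ((2 * N) ^ k * (1 / (k - 1).factorial)) := by rw [mul_pow]; ring
    _ ≤ Q * K ^ (N + 1) * ((2 * N) ^ k * ((k + 1) / k.factorial)) := by gcongr
    _ = Q * K ^ (N + 1) * ((k + 1) * ((2 * N) ^ k / k.factorial)) := by ring
    _ ≤ Q * K ^ (N + 1) * (Real.exp (N + 1) * Real.exp (2 * N)) := by gcongr
    _ ≤ Q * K ^ (N + 1) * Real.exp (3 * (N + 1)) := by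
        rw [← Real.exp_add]
        gcongr
        linarith

theorem pow_div_factorial_le_quarter_pow {x : ℝ} {m : ℕ} (hx : 0 ≤ x) (hxm : 16 * x ≤ m) :
    x ^ m / m.factorial ≤ (1 / 4) ^ m := by
  have h1 := Real.pow_div_factorial_le_exp (m : ℝ) (by positivity) m
  have h2 : x ≤ m / 16 := by linarith
  have h3 : Real.exp m ≤ 4 ^ m := by
    rw [← mul_one (m : ℝ), Real.exp_nat_mul]
    gcongr
    linarith [Real.exp_one_lt_d9]
  calc x ^ m / m.factorial ≤ (m / 16) ^ m / m.factorial := by gcongr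
    _ = (1 / 16) ^ m * ((m : ℝ) ^ m / m.factorial) := by
        rw [div_eq_mul_one_div (m : ℝ), mul_pow]
        ring
    _ ≤ (1 / 16) ^ m * 4 ^ m := by gcongr; exact h1.trans h3
    _ = (1 / 4) ^ m := by
        rw [← mul_pow]
        norm_num

/-- Low frequencies, if the moments of order less than `m` are bounded by `Y`. -/
theorem norm_low_circleCoeff_le {g : ℝ → ℂ} (hg : Continuous g) (hs : ∀ x, 2 ≤ |x| → g x = 0)
    {B Y : ℝ} (hB : ∀ x, ‖g x‖ ≤ B) {m : ℕ}
    (hY : ∀ k < m, ‖∫ x in (-2 : ℝ)..2, (x : ℂ) ^ k * g x‖ ≤ Y) {n : ℤ} (hn : 32 * |(n : ℝ)| ≤ m)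
    (hY0 : 0 ≤ Y) :
    ‖circleCoeff g n‖ ≤ Real.exp m * Y + 8 * B * (1 / 4) ^ m := by
  have hB0 : 0 ≤ B := (norm_nonneg _).trans (hB 0)
  refine (norm_circleCoeff_le hg hs hB n m (by linarith [abs_nonneg (n : ℝ)])).trans
    (add_le_add ?_ ?_)
  · calc ∑ k ∈ Finset.range m, |(n : ℝ)| ^ k / k.factorial *
          ‖∫ x in (-2 : ℝ)..2, (x : ℂ) ^ k * g x‖
        ≤ ∑ k ∈ Finset.range m, |(n : ℝ)| ^ k / k.factorial * Y := by
          refine Finset.sum_le_sum fun k hk => ?_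
          gcongr
          exact hY k (Finset.mem_range.1 hk)
      _ = (∑ k ∈ Finset.range m, |(n : ℝ)| ^ k / k.factorial) * Y := by rw [Finset.sum_mul]
      _ ≤ Real.exp |(n : ℝ)| * Y := by
          gcongr
          exact Real.sum_le_exp_of_nonneg (abs_nonneg _) m
      _ ≤ Real.exp m * Y := by
          gcongr
          linarith [abs_nonneg (n : ℝ)]
  · gcongr
    exact pow_div_factorial_le_quarter_pow (by positivity) (by linarith)

theorem card_filter_abs_le {m : ℕ} (S : Finset ℤ) :
    ((S.filter fun n : ℤ => 32 * |(n : ℝ)| ≤ m).card : ℝ) ≤ m + 1 := by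
  have h : S.filter (fun n : ℤ => 32 * |(n : ℝ)| ≤ m) ⊆
      Finset.Icc (-((m / 32 : ℕ) : ℤ)) (m / 32 : ℕ) := by
    intro n hn
    have h1 := (Finset.mem_filter.1 hn).2
    have h2 : 32 * |n| ≤ (m : ℤ) := by exact_mod_cast h1
    rw [Finset.mem_Icc, ← abs_le]
    omega
  have h2 := Finset.card_le_card h
  rw [Int.card_Icc] at h2
  have h3 : (S.filter fun n : ℤ => 32 * |(n : ℝ)| ≤ m).card ≤ m + 1 := by omega
  exact_mod_cast h3

/-- Frequencies are split at $|n|=m/32$. The at most $m+1$ low ones are exponentially small in $m$;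
the high ones are estimated with $r=64/m$, which is at most $1$ because $m\ge64$. -/
theorem integral_sq_le_of_moments {g : ℝ → ℂ} (hg : Continuous g) (hs : ∀ x, 2 ≤ |x| → g x = 0)
    {A B M Y α : ℝ} (hα : 0 ≤ α) (hα1 : α ≤ 1) (hA : 0 ≤ A) (hB : ∀ x, ‖g x‖ ≤ B)
    (hH : ∀ h x, 0 ≤ h → h ≤ 1 → ‖g (x + h) - g x‖ ≤ A * h ^ α) {m : ℕ} (hm : 64 ≤ m)
    (hY : ∀ k < m, ‖∫ x in (-2 : ℝ)..2, (x : ℂ) ^ k * g x‖ ≤ Y)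
    (hYM : Real.exp m * Y ≤ M * (1 / 4) ^ m) (hBM : 8 * B ≤ M) (hAM : 200 * A ≤ M) :
    ∫ x in (-Real.pi)..Real.pi, ‖g x‖ ^ 2 ≤ 2 * (M * (1 / (m + 1)) ^ α) ^ 2 := by
  have hm' : (64 : ℝ) ≤ m := by exact_mod_cast hm
  have hmp : (0 : ℝ) < m := by linarith
  have hM : 0 ≤ M := by linarith
  have hY0 : 0 ≤ Y := (norm_nonneg _).trans (hY 0 (by omega))
  have hpi := Real.pi_gt_three
  have hpi4 := Real.pi_le_four
  set q : ℝ := (1 / (m + 1)) ^ α with hq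
  have hq0 : 0 ≤ q := by positivity
  have hlowq : 1 / (m + 1 : ℝ) ≤ q := by
    have := Real.rpow_le_rpow_of_exponent_ge (x := 1 / (m + 1 : ℝ)) (by positivity)
      (by rw [div_le_one (by positivity)]; linarith) hα1
    rwa [Real.rpow_one] at this
  -- $64/m\le65/(m+1)$ holds exactly when $m\ge64$.
  have hhighq : (64 / m : ℝ) ^ α ≤ 65 * q := by
    calc (64 / m : ℝ) ^ α ≤ (65 * (1 / (m + 1))) ^ α := by
          gcongr
          rw [mul_one_div, div_le_div_iff₀ hmp (by positivity)]
          linarith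
      _ = 65 ^ α * q := Real.mul_rpow (by norm_num) (by positivity)
      _ ≤ 65 * q := by
          gcongr
          exact rpow_le_self_of_one_le (by norm_num) hα1
  have hsum : ∀ S : Finset ℤ, ∑ n ∈ S, ‖circleCoeff g n‖ ^ 2 ≤
      (m + 1) * (2 * M * (1 / 4) ^ m) ^ 2 + 4 * Real.pi ^ 2 * (A * (65 * q)) ^ 2 := by
    intro S
    rw [← Finset.sum_filter_add_sum_filter_not S (fun n : ℤ => 32 * |(n : ℝ)| ≤ m)]
    refine add_le_add ?_ ?_
    · calc ∑ n ∈ S.filter (fun n : ℤ => 32 * |(n : ℝ)| ≤ m), ‖circleCoeff g n‖ ^ 2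
          ≤ ∑ n ∈ S.filter (fun n : ℤ => 32 * |(n : ℝ)| ≤ m), (2 * M * (1 / 4) ^ m) ^ 2 := by
            refine Finset.sum_le_sum fun n hn => ?_
            gcongr
            refine (norm_low_circleCoeff_le hg hs hB hY (Finset.mem_filter.1 hn).2 hY0).trans ?_
            have : 8 * B * (1 / 4) ^ m ≤ M * (1 / 4) ^ m := by gcongr
            linarith
        _ ≤ (m + 1) * (2 * M * (1 / 4) ^ m) ^ 2 := by
            rw [Finset.sum_const, nsmul_eq_mul]
            gcongr
            exact card_filter_abs_le S
    · refine (sum_high_circleCoeff_le hg hs hα hA (r := 64 / m) (by positivity)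
        (by rw [div_le_one hmp]; exact hm') hH _ fun n hn => ?_).trans (by gcongr)
      have := not_le.1 (Finset.mem_filter.1 hn).2
      rw [mul_div_assoc', le_div_iff₀ hmp]
      linarith
  have htot := hasSum_le_of_sum_le (hasSum_sq_circleCoeff hg) hsum
  have hgeom : (m + 1 : ℝ) * ((1 / 4 : ℝ) ^ m) ^ 2 ≤ q ^ 2 := by
    have h1 : (m + 1 : ℝ) ≤ 2 ^ m := by exact_mod_cast Nat.lt_two_pow_self
    have h2 : (m + 1 : ℝ) ^ 3 * ((1 / 4 : ℝ) ^ m) ^ 2 ≤ 1 := by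
      calc (m + 1 : ℝ) ^ 3 * ((1 / 4 : ℝ) ^ m) ^ 2 ≤ (2 ^ m) ^ 3 * ((1 / 4 : ℝ) ^ m) ^ 2 := by
            gcongr
        _ = (1 / 2) ^ m := by
            rw [← pow_mul, ← pow_mul, mul_comm m, mul_comm m, pow_mul, pow_mul, ← mul_pow]
            norm_num
        _ ≤ 1 := pow_le_one₀ (by norm_num) (by norm_num)
    calc (m + 1 : ℝ) * ((1 / 4 : ℝ) ^ m) ^ 2
        = (m + 1 : ℝ) ^ 3 * ((1 / 4 : ℝ) ^ m) ^ 2 * (1 / (m + 1)) ^ 2 := by field_simp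
      _ ≤ 1 * q ^ 2 := by gcongr
      _ = q ^ 2 := one_mul _
  have hAq : 200 * (A * q) ≤ M * q := by nlinarith
  have hAq0 : 0 ≤ A * q := by positivity
  have hA2 : 40000 * (A * q) ^ 2 ≤ (M * q) ^ 2 := by nlinarith
  have hlow2 : (m + 1) * (2 * M * (1 / 4) ^ m) ^ 2 ≤ 4 * (M * q) ^ 2 := by
    calc (m + 1) * (2 * M * (1 / 4) ^ m) ^ 2
        = 4 * M ^ 2 * ((m + 1 : ℝ) * ((1 / 4 : ℝ) ^ m) ^ 2) := by ring
      _ ≤ 4 * M ^ 2 * q ^ 2 := by gcongr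
      _ = _ := by ring
  set I := ∫ x in (-Real.pi)..Real.pi, ‖g x‖ ^ 2
  have hfin : 2 * Real.pi * I ≤ 2 * Real.pi * (2 * (M * q) ^ 2) := by
    have e : 4 * Real.pi ^ 2 * (A * (65 * q)) ^ 2 = Real.pi * (Real.pi * 16900 * (A * q) ^ 2) := by
      ring
    -- $16900=4\cdot65^2$, and $\pi\cdot16900\le4\cdot16900<2\cdot200^2$; hence the factor $200$ in
    -- `hAM`.
    have h4 : Real.pi * 16900 * (A * q) ^ 2 ≤ 2 * (M * q) ^ 2 := by nlinarith [sq_nonneg (A * q)]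
    have h5 : Real.pi * (Real.pi * 16900 * (A * q) ^ 2) ≤ Real.pi * (2 * (M * q) ^ 2) := by gcongr
    nlinarith [sq_nonneg (M * q)]
  exact le_of_mul_le_mul_left hfin (by positivity)

end

/-! ### Choice of the constants and conclusion. -/

theorem exp_mul_moment_bound_le {c K ε H M a : ℝ} {m : ℕ} (hm : 1 ≤ m) (hc : 0 ≤ c) (hK : 0 ≤ K)
    (hε : 0 < ε) (hH : 0 < H) (ha : a = (c + 1) * K * Real.exp 6)
    (h : (a / ε) ^ m ≤ M / H) :
    Real.exp m * (c * H * (K / ε) ^ m * Real.exp (3 * m)) ≤ M * (1 / 4) ^ m := by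
  rw [le_div_iff₀ hH] at h
  have h4 : (4 : ℝ) ≤ Real.exp 2 := by
    have h1 : (2 : ℝ) ≤ Real.exp 1 := by linarith [Real.add_one_le_exp (1 : ℝ)]
    have h2 : Real.exp 2 = Real.exp 1 * Real.exp 1 := by
      rw [← Real.exp_add]
      norm_num
    nlinarith
  have hcm : c ≤ (c + 1) ^ m := by
    calc c ≤ c + 1 := by linarith
      _ = (c + 1) ^ 1 := (pow_one _).symm
      _ ≤ (c + 1) ^ m := pow_le_pow_right₀ (by linarith) hm
  -- The exponent $6=1+3+2$ collects the Taylor sum, the moment growth and the required gain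
  -- $4^{-m}$, as $4\le e^2$.
  have he : Real.exp m * Real.exp (3 * m) * 4 ^ m ≤ Real.exp 6 ^ m := by
    calc Real.exp m * Real.exp (3 * m) * 4 ^ m
        ≤ Real.exp m * Real.exp (3 * m) * Real.exp 2 ^ m := by gcongr
      _ = Real.exp 6 ^ m := by
          rw [← Real.exp_nat_mul, ← Real.exp_nat_mul, ← Real.exp_add, ← Real.exp_add]
          congr 1
          ring
  have e : (a / ε) ^ m = (c + 1) ^ m * (K / ε) ^ m * Real.exp 6 ^ m := by
    rw [ha, ← mul_pow, ← mul_pow]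
    congr 1
    ring
  have key : Real.exp m * (c * H * (K / ε) ^ m * Real.exp (3 * m)) * 4 ^ m ≤ M := by
    calc Real.exp m * (c * H * (K / ε) ^ m * Real.exp (3 * m)) * 4 ^ m
        = c * (K / ε) ^ m * (Real.exp m * Real.exp (3 * m) * 4 ^ m) * H := by ring
      _ ≤ (c + 1) ^ m * (K / ε) ^ m * Real.exp 6 ^ m * H := by gcongr
      _ ≤ M := by rwa [← e]
  rw [one_div, inv_pow, ← div_eq_mul_inv, le_div_iff₀ (by positivity)]
  exact key

theorem eLpNorm_vmean_le {c : ℝ≥0} {nrm : ℝ → ℝ → (ℝ → ℝ → ℂ) → ℝ≥0∞}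
    {f : EuclideanSpace ℝ (Fin 2) → ℂ} {ε γ H C₁ M : ℝ} {φ : ℕ → ℝ → ℝ} {C₀ α : ℝ≥0}
    (hα0 : 0 < α) (hα : α ≤ 1) (hfH : HolderWith C₀ α f) (hn : IsDataNorm c nrm)
    (hs : tsupport f ⊆ parabola) (hε : 0 < ε) (hε1 : ε < 1) (hγε : ε ^ 2 / 4 ≤ γ) (hγ1 : γ < 1)
    (hH : 0 < H) (h : nrm ε γ (radon f) = ENNReal.ofReal H) (hφ : IsMollifierSeq C₁ φ)
    (hM : 400 * C₀ ≤ M) {N : ℕ} (hN : 63 ≤ N)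
    (hMH : ((c + 1) * max C₁ 1 * Real.exp 6 / ε) ^ (N + 1) ≤ M / H) :
    eLpNorm (vmean (φ N) ε γ f) 2 volume ≤
      ENNReal.ofReal (2 * (M * (1 / (N + 2)) ^ (α : ℝ))) := by
  have hf := hfH.continuous hα0
  obtain ⟨hφN, hφd⟩ := hφ N
  have hC₁ : 0 ≤ C₁ := by simpa using (abs_nonneg _).trans (hφd 0 (Nat.zero_le _) 0)
  have hM0 : 0 ≤ M := le_trans (by positivity) hM
  rw [funext (vmean_eq_slopeMean hφN hε γ f)]
  set g := slopeMean (dilate (φ N) ε) ε γ (fun x y => f !₂[x, y])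
  have hg : Continuous g := continuous_slopeMean hf hφN
  have hgs : ∀ x, 2 ≤ |x| → g x = 0 := fun x hx => slopeMean_eq_zero hf hs hε.le hε1.le hγ1.le hx
  have hgB : ∀ x, ‖g x‖ ≤ 3 * C₀ := norm_slopeMean_le hα hα0 hfH hs hφN hε hε1.le hγ1.le
  have hK : 1 ≤ max C₁ 1 / ε := by
    rw [one_le_div hε]
    exact hε1.le.trans (le_max_right _ _)
  have hmom : ∀ k < N + 1, ‖∫ x in (-2 : ℝ)..2, (x : ℂ) ^ k * g x‖ ≤
      c * H * (max C₁ 1 / ε) ^ (N + 1) * Real.exp (3 * ((N + 1 : ℕ) : ℝ)) := by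
    intro k hk
    have hk' : k ≤ N := Nat.lt_succ_iff.1 hk
    push_cast
    refine norm_moment_le_exp hk' hK (by positivity)
      ((norm_moment_le hn hf hs hε hε1 hγε hγ1 hH.le h hφN (hφd k hk')).trans ?_)
    rw [div_pow, mul_div_right_comm]
    gcongr
    exact le_max_left _ _
  -- Applied with $m=N+1$, $A=2C_0$ and $B=3C_0$; $200A\le M$ is the condition $400C_0\le M$.
  have hI := integral_sq_le_of_moments (α := α) hg hgs α.coe_nonneg (by exact_mod_cast hα)
    (by positivity) hgB
    (fun h x h0 _ => norm_slopeMean_sub_le hα hα0 hfH hφN hε hε1.le h0 x) (by omega : 64 ≤ N + 1)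
    hmom (exp_mul_moment_bound_le (by omega) c.coe_nonneg (by positivity) hε hH rfl hMH)
    (by linarith [C₀.coe_nonneg]) (by linarith)
  rw [eLpNorm_two_eq_sqrt hg hgs]
  refine ENNReal.ofReal_le_ofReal (Real.sqrt_le_iff.2 ⟨by positivity, hI.trans ?_⟩)
  push_cast
  rw [show (N : ℝ) + 1 + 1 = N + 2 by ring]
  nlinarith [sq_nonneg (M * (1 / (N + 2 : ℝ)) ^ (α : ℝ))]

end LocalRadon

theorem theorem3 :
    (∃ (C₁ : ℝ) (φ : ℕ → ℝ → ℝ), LocalRadon.IsMollifierSeq C₁ φ) ∧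
    ∀ C₀ : ℝ≥0, ∃ M : ℝ, 0 < M ∧
      ∀ (C₁ : ℝ) (c : ℝ≥0), ∃ C : ℝ, 1 ≤ C ∧
        ∀ ε : ℝ, 0 < ε → ε < 1 → ∃ δ : ℝ, 0 < δ ∧ δ ≤ M ∧
          ∀ (α : ℝ≥0) (γ : ℝ) (φ : ℕ → ℝ → ℝ) (nrm : ℝ → ℝ → (ℝ → ℝ → ℂ) → ℝ≥0∞)
            (f : EuclideanSpace ℝ (Fin 2) → ℂ),
            0 < α → α ≤ 1 → ε ^ 2 / 4 ≤ γ → γ < 1 →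
            LocalRadon.IsMollifierSeq C₁ φ → LocalRadon.IsDataNorm c nrm →
            HolderWith C₀ α f → tsupport f ⊆ LocalRadon.parabola →
            ∀ H : ℝ, 0 ≤ H → H < δ →
              nrm ε γ (LocalRadon.radon f) = ENNReal.ofReal H →
              (0 < H →
                eLpNorm
                    (LocalRadon.vmean (φ (LocalRadon.mollifierIndex M C ε H)) ε γ f) 2 volume ≤
                  ENNReal.ofReal
                    (4 * M * (Real.log (C / ε) / Real.log (M / H)) ^ (α : ℝ))) ∧
              (H = 0 → ∀ N : ℕ, eLpNorm (LocalRadon.vmean (φ N) ε γ f) 2 volume = 0) := by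
  refine ⟨LocalRadon.exists_isMollifierSeq, fun C₀ => ?_⟩
  -- Adding $1$ keeps $M$ positive when $C_0=0$.
  set M : ℝ := 400 * (C₀ + 1) with hM
  have hM0 : 0 < M := by positivity
  refine ⟨M, hM0, fun C₁ c => ?_⟩
  set C : ℝ := (c + 1) * max C₁ 1 * Real.exp 6 with hC
  have hC1 : 1 ≤ C := by
    have h1 : 1 ≤ (c : ℝ) + 1 := by linarith [c.coe_nonneg]
    exact one_le_mul_of_one_le_of_one_le
      (one_le_mul_of_one_le_of_one_le h1 (le_max_right _ _)) (Real.one_le_exp (by norm_num))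
  refine ⟨C, hC1, fun ε hε hε1 => ?_⟩
  have hCε : 1 < C / ε := by
    rw [one_lt_div hε]
    linarith
  have hCp : 0 < C / ε := by linarith
  -- $H<\delta$ means $\log(M/H)>64\log(C/\varepsilon)$, which forces $N\ge63$, that is
  -- $m=N+1\ge64$.
  refine ⟨M / (C / ε) ^ 64, by positivity, div_le_self hM0.le (one_le_pow₀ hCε.le), ?_⟩
  intro α γ φ nrm f hα0 hα hγε hγ1 hφ hn hfH hs H hH0 hHδ hH
  refine ⟨fun hHp => ?_, ?_⟩
  · set l := Real.log (C / ε) with hl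
    set L := Real.log (M / H) with hL
    have hl0 : 0 < l := Real.log_pos hCε
    have hMH : (C / ε) ^ 64 < M / H := by
      rw [lt_div_iff₀ (by positivity)] at hHδ
      rw [lt_div_iff₀ hHp]
      linarith
    have hL64 : 64 * l < L := by
      have := Real.log_lt_log (by positivity) hMH
      rw [Real.log_pow] at this
      exact_mod_cast this
    have hL0 : 0 < L := by linarith
    have hx0 : 0 ≤ (L - l) / l := div_nonneg (by linarith) hl0.le
    set N := LocalRadon.mollifierIndex M C ε H with hN
    have hN1 : (N : ℝ) ≤ (L - l) / l := Nat.floor_le hx0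
    have hN2 : (L - l) / l < N + 1 := Nat.lt_floor_add_one _
    have hN63 : 63 ≤ N := by
      refine Nat.le_floor ?_
      rw [le_div_iff₀ hl0]
      push_cast
      linarith
    -- The floor says $N+1\le L/l<N+2$: the left half gives $(C/\varepsilon)^{N+1}\le M/H$, the
    -- right half $1/(N+2)\le l/L$.
    rw [le_div_iff₀ hl0] at hN1
    rw [div_lt_iff₀ hl0] at hN2
    have hpow : (C / ε) ^ (N + 1) ≤ M / H := by
      rw [← Real.log_le_log_iff (by positivity) (by positivity), Real.log_pow]
      push_cast
      linarith
    refine (LocalRadon.eLpNorm_vmean_le hα0 hα hfH hn hs hε hε1 hγε hγ1 hHp hH hφ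
      (by linarith) hN63 hpow).trans (ENNReal.ofReal_le_ofReal ?_)
    have hq : (1 / (N + 2) : ℝ) ^ (α : ℝ) ≤ (l / L) ^ (α : ℝ) := by
      gcongr ?_ ^ _
      rw [div_le_div_iff₀ (by positivity) hL0]
      linarith
    have hq0 : 0 ≤ M * (l / L) ^ (α : ℝ) := by positivity
    nlinarith [mul_le_mul_of_nonneg_left hq hM0.le]
  · rintro rfl N
    exact LocalRadon.eLpNorm_vmean_eq_zero hα0 hα hfH hn hs hε hε1 hγε hγ1 (by simpa using hH)
      (hφ N).1
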